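/- Let $C\subset\mathbb{R}^2$ be a convex body, that is, a bounded convex set with non-empty interior. For an angle $\theta\in\mathbb{T}_{2\pi}=\mathbb{R}/2\pi\mathbb{Z}$ let $\mathbf{u}(\theta)=(\cos\theta,\sin\theta)$, and for $\lambda>0$ put $$K_C(\theta,\lambda)=\Big\{\mathbf{x}\in C:\ \mathbf{x}\cdot\mathbf{u}(\theta)=\inf_{\mathbf{y}\in C}\mathbf{y}\cdot\mathbf{u}(\theta)+\lambda\Big\},\qquad \gamma_C(\theta,\lambda)=\max\{|K_C(\theta,\lambda)|,\,|K_C(\theta+\pi,\lambda)|\},$$ where $|K_C(\theta,\lambda)|$ is the length of the segment $K_C(\theta,\lambda)$. Let $\boldsymbol{\Gamma}_C\colon\mathbb{R}/|\partial C|\mathbb{Z}\to\mathbb{R}^2$ be the arc-length parameterization of the boundary $\partial C$, let $$\nu_C(s)=\Big\{\theta\in\mathbb{T}_{2\pi}:\ \inf_{\mathbf{y}\in C}\mathbf{y}\cdot\mathbf{u}(\theta)=\boldsymbol{\Gamma}_C(s)\cdot\mathbf{u}(\theta)\Big\},$$ and for a set $J\subset\mathbb{T}_{2\pi}$ let $P_C(J)=\big|\{s\in\mathbb{R}/|\partial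 C|\mathbb{Z}:\ \nu_C(s)\cap J\neq\varnothing\}\big|$ (Lebesgue measure). Then for every closed interval $I\subseteq\mathbb{T}_{2\pi}$ of positive length $|I|\le 2\pi$, $$\liminf_{\rho\to+\infty}\ \rho\int_I\gamma_C^2(\theta,\rho^{-1})\,d\theta\ \geq\ P_C(I)+P_C(I+\pi)$$ and $$\limsup_{\rho\to+\infty}\ \rho\int_I\gamma_C^2(\theta,\rho^{-1})\,d\theta\ \leq\ 8P_C(I)+8P_C(I+\pi).$$ -/

import Mathlib

open Filter MeasureTheory

noncomputable section

namespace PlanarBody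

/-- The Euclidean plane. -/
abbrev Plane : Type := EuclideanSpace ℝ (Fin 2)

/-- A convex body: a bounded convex subset of the plane with non-empty interior
(it is not required to be closed). -/
structure IsConvexBody (C : Set Plane) : Prop where
  convex : Convex ℝ C
  isBounded : Bornology.IsBounded C
  nonempty_interior : (interior C).Nonempty

/-- The unit vector `u(θ) = (cos θ, sin θ)`, for an angle `θ` in `ℝ / 2πℤ`. -/
def u (θ : Real.Angle) : Plane := !₂[θ.cos, θ.sin]

/-- The infimum of `y · u(θ)` over `y ∈ C`. It is a minimum when `C` is compact. -/
def supportInf (C : Set Plane) (θ : Real.Angle) : ℝ := ⨅ y : C, inner ℝ (y : Plane) (u θ)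

/-- The chord `K_C(θ, lam)` of `C` in direction `u(θ)` at distance `lam`. -/
def chord (C : Set Plane) (θ : Real.Angle) (lam : ℝ) : Set Plane :=
  {x ∈ C | inner ℝ x (u θ) = supportInf C θ + lam}

/-- The length of the chord. For convex bounded `C` the chord is a (possibly empty, possibly
non-closed) bounded line segment, and its length is its diameter. -/
def chordLength (C : Set Plane) (θ : Real.Angle) (lam : ℝ) : ℝ := Metric.diam (chord C θ lam)

/-- `γ_C(θ, lam) = max {|K_C(θ, lam)|, |K_C(θ + π, lam)|}`. -/
def gam (C : Set Plane) (θ : Real.Angle) (lam : ℝ) : ℝ :=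
  max (chordLength C θ lam) (chordLength C (θ + (Real.pi : Real.Angle)) lam)

/-- A chosen interior point of `C` (arbitrary if the interior is empty). -/
def center (C : Set Plane) : Plane := Classical.epsilon fun x => x ∈ interior C

/-- The closed curve `∂C`, run through counterclockwise by the polar angle around an interior
point `c`: the point of `∂C` on the ray from `c` in direction `u(t)`. As `gauge (C - c)` is the
Minkowski functional of `C` seen from `c`, that point is `c + u(t) / gauge (C - c) (u(t))`. -/
def polarCurve (C : Set Plane) (t : ℝ) : Plane :=
  center C + (gauge ((fun x => x - center C) '' C) (u t))⁻¹ • u t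

/-- The perimeter `|∂C|`: the length (total variation) of one turn of the boundary curve. -/
def perimeter (C : Set Plane) : ℝ :=
  (eVariationOn (polarCurve C) (Set.Icc 0 (2 * Real.pi))).toReal

/-- The arc-length parameterization `Γ_C` of `∂C`, as a function on `ℝ` (of period `|∂C|`): the
boundary curve reparameterized by its length, counted from the polar angle `0`. -/
def arcParam (C : Set Plane) : ℝ → Plane :=
  naturalParameterization (polarCurve C) Set.univ 0

/-- The set of normals `ν_C(s)` at `Γ_C(s)`. -/
def normals (C : Set Plane) (s : ℝ) : Set Real.Angle :=
  {θ | supportInf C θ = inner ℝ (arcParam C s) (u θ)}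

/-- The portion of perimeter `P_C(I)`: the Lebesgue measure of the set of arc-length parameters
`s` modulo `|∂C|`, represented by `0 ≤ s < |∂C|`, for which `ν_C(s)` meets `I`. -/
def portion (C : Set Plane) (I : Set Real.Angle) : ENNReal :=
  volume {s : ℝ | s ∈ Set.Ico 0 (perimeter C) ∧ (normals C s ∩ I).Nonempty}

/-- The closed interval (arc) of angles from `a` to `b`, meant for `a < b ≤ a + 2π`. -/
def arc (a b : ℝ) : Set Real.Angle := (fun t : ℝ => (t : Real.Angle)) '' Set.Icc a b

/-- The set of angles `I + π`. -/
def opposite (I : Set Real.Angle) : Set Real.Angle := (fun θ => θ + (Real.pi : Real.Angle)) '' I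

end PlanarBody

end

noncomputable section

namespace PlanarBody

open scoped Topology ENNReal NNReal

/-! Write X for the arc-length curve, h(θ) = inf y·u(θ), u' for the derivative of u, and k(s,θ) =
X(s)·u(θ) − h(θ) ≥ 0 for the height of X(s) over the supporting line. The chord at distance lam cuts
off the cap {s : k(s,θ) < lam}. Let r(s) = X(s)·u'(θ) − h'(θ), the tangential coordinate measured
from the contact point. The integral of |r|(−r') over the cap telescopes to `sweep` = B|B|/2 −
A|A|/2, where A ≤ B are the values of r at the ends of the chord and ℓ = B − A is its length
(`HasRadii.sweep_eq`). Always ℓ² ≤ 4·sweep (`chordLength_sq_le`). As the contact point lies over the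
chord up to O(lam), also sweep ≤ (1/2 + ε)ℓ² + O(lam²) (`sweep_le`).

Now integrate over θ ∈ I and exchange the integrals. At almost every s the normal θ₀ is unique
modulo 2π and X'(s) = −u'(θ₀), while r = ∂k/∂θ for almost every θ, so the integrand is |∂k/∂θ| cos(θ
− θ₀) (`density_eq`). For fixed s, k vanishes at θ₀ and increases on both sides up to a quarter
turn, so |∂k/∂θ| integrates over {k < lam} to at most lam per side. The positive part thus
contributes at most 2·lam (`posSweep_le`). It contributes at least about lam if s touches in I,
where only one side need lie in I (`eventually_le_posSweep`), and nothing for small lam otherwise.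
The negative part, from cos < 0, is O(lam) and vanishes for small lam at almost every s, so
dominated convergence discards it (`tendsto_lintegral_negSweep`). Asymptotically ρ∫sweep therefore
lies between P(I) and 2P(I).

The constants follow. γ² is at most the sum of the squared chord lengths at θ and θ + π, which gives
4·2 = 8. It is at least each of them, so adding the two lower estimates costs 2(1/2 + ε), and ε → 0
gives 1. -/

/-! ### Integrals of |f'| over sublevel sets of f. -/

theorem deriv_nonneg_of_monotoneOn {f : ℝ → ℝ} {x z t : ℝ} (hm : MonotoneOn f (Set.Icc x z))
    (ht : t ∈ Set.Ioo x z) : 0 ≤ deriv f t := by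
  have h : Set.Icc x z ∈ 𝓝 t := Icc_mem_nhds ht.1 ht.2
  rw [← derivWithin_of_mem_nhds h]
  exact hm.derivWithin_nonneg

/-- The derivative of a monotone function has integral at most the increment. -/
theorem lintegral_enorm_deriv_le_of_monotoneOn {f : ℝ → ℝ} {x z : ℝ} (hxz : x ≤ z)
    (hm : MonotoneOn f (Set.Icc x z)) :
    ∫⁻ t in Set.Icc x z, ‖deriv f t‖ₑ ≤ ENNReal.ofReal (f z - f x) := by
  have hm' : MonotoneOn f (Set.uIcc x z) := by rwa [Set.uIcc_of_le hxz]
  have hi := hm'.intervalIntegrable_deriv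
  have hle := hm'.intervalIntegral_deriv_mem_uIcc
  rw [Set.uIcc_of_le (by have := hm ⟨le_rfl, hxz⟩ ⟨hxz, le_rfl⟩ hxz; linarith)] at hle
  have hnn : ∀ᵐ t ∂volume.restrict (Set.Icc x z), 0 ≤ deriv f t := by
    rw [← restrict_Ioo_eq_restrict_Icc]
    filter_upwards [ae_restrict_mem measurableSet_Ioo] with t ht
    exact deriv_nonneg_of_monotoneOn hm ht
  rw [intervalIntegrable_iff_integrableOn_Icc_of_le hxz] at hi
  rw [intervalIntegral.integral_of_le hxz, ← integral_Icc_eq_integral_Ioc] at hle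
  calc ∫⁻ t in Set.Icc x z, ‖deriv f t‖ₑ = ∫⁻ t in Set.Icc x z, ENNReal.ofReal (deriv f t) := by
        refine lintegral_congr_ae ?_
        filter_upwards [hnn] with t ht
        rw [Real.enorm_eq_ofReal ht]
    _ = ENNReal.ofReal (∫ t in Set.Icc x z, deriv f t) :=
        (ofReal_integral_eq_lintegral_ofReal hi hnn).symm
    _ ≤ _ := ENNReal.ofReal_le_ofReal hle.2

/-- The sublevel set lies in [x, y] with y its supremum, and f(y) ≤ μ by continuity, so f increases
by at most μ there. -/
theorem lintegral_enorm_deriv_sublevel_le {f : ℝ → ℝ} {x z μ : ℝ}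
    (hf : ContinuousOn f (Set.Icc x z)) (hm : MonotoneOn f (Set.Icc x z)) (h0 : 0 ≤ f x) :
    ∫⁻ t in Set.Icc x z ∩ {t | f t < μ}, ‖deriv f t‖ₑ ≤ ENNReal.ofReal μ := by
  rcases (Set.Icc x z ∩ {t | f t < μ}).eq_empty_or_nonempty with h | hne
  · simp [h]
  set S := Set.Icc x z ∩ {t | f t < μ} with hS
  have hbdd : BddAbove S := ⟨z, fun t ht => ht.1.2⟩
  obtain ⟨t₀, ht₀⟩ := hne
  have hcl : IsClosed (Set.Icc x z ∩ f ⁻¹' Set.Iic μ) :=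
    hf.preimage_isClosed_of_isClosed isClosed_Icc isClosed_Iic
  have hy : sSup S ∈ Set.Icc x z ∩ f ⁻¹' Set.Iic μ :=
    closure_minimal (fun t (ht : t ∈ S) => Set.mem_inter ht.1 (show f t < μ from ht.2).le) hcl (csSup_mem_closure ⟨t₀, ht₀⟩ hbdd)
  have hsub : S ⊆ Set.Icc x (sSup S) := fun t ht => ⟨ht.1.1, le_csSup hbdd ht⟩
  refine (lintegral_mono_set hsub).trans
    ((lintegral_enorm_deriv_le_of_monotoneOn hy.1.1
      (hm.mono (Set.Icc_subset_Icc_right hy.1.2))).trans (ENNReal.ofReal_le_ofReal ?_))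
  have := hy.2
  simp only [Set.mem_preimage, Set.mem_Iic] at this
  linarith

/-- While a Lipschitz function goes up from `0` to `μ`, the integral of its derivative over the
sublevel set `{f < μ}` is at least `μ`. -/
theorem le_lintegral_enorm_deriv_sublevel {f : ℝ → ℝ} {K : ℝ≥0} {x z μ : ℝ}
    (hf : LipschitzWith K f) (hxz : x ≤ z) (h0 : f x = 0) (hμ : 0 < μ) (hz : μ ≤ f z) :
    ENNReal.ofReal μ ≤ ∫⁻ t in Set.Icc x z ∩ {t | f t < μ}, ‖deriv f t‖ₑ := by
  set S := Set.Icc x z ∩ f ⁻¹' Set.Ici μ with hS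
  have hcl : IsClosed S :=
    hf.continuous.continuousOn.preimage_isClosed_of_isClosed isClosed_Icc isClosed_Ici
  have hbdd : BddBelow S := ⟨x, fun t ht => ht.1.1⟩
  have hne : S.Nonempty := ⟨z, ⟨hxz, le_rfl⟩, hz⟩
  have hy := hcl.csInf_mem hne hbdd
  -- The first parameter at which f reaches μ; before it f < μ, and f' integrates to f y ≥ μ.
  set y := sInf S
  have hyμ : μ ≤ f y := hy.2
  have hsub : Set.Ioo x y ⊆ Set.Icc x z ∩ {t | f t < μ} := by
    intro t ht
    refine ⟨⟨ht.1.le, ht.2.le.trans hy.1.2⟩, ?_⟩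
    by_contra hcon
    have hcon' : μ ≤ f t := not_lt.mp hcon
    exact absurd (csInf_le hbdd (show t ∈ S from ⟨⟨ht.1.le, ht.2.le.trans hy.1.2⟩, hcon'⟩))
      (not_le.mpr ht.2)
  refine le_trans ?_ (lintegral_mono_set hsub)
  have hac := (hf.lipschitzOnWith (s := Set.uIcc x y)).absolutelyContinuousOnInterval
  have h1 := hac.integral_deriv_eq_sub
  rw [intervalIntegral.integral_of_le hy.1.1] at h1
  have h2 := enorm_integral_le_lintegral_enorm (μ := volume.restrict (Set.Ioc x y)) (deriv f)
  rw [h1, h0, sub_zero, Real.enorm_eq_ofReal (hμ.le.trans hyμ), ← restrict_Ioo_eq_restrict_Ioc]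
    at h2
  exact (ENNReal.ofReal_le_ofReal hyμ).trans h2

theorem lintegral_enorm_deriv_comp_neg (f : ℝ → ℝ) (c : ℝ) (s : Set ℝ) :
    ∫⁻ t in (fun t => c - t) ⁻¹' s, ‖deriv (fun t => f (c - t)) t‖ₑ = ∫⁻ t in s, ‖deriv f t‖ₑ := by
  have hmp : MeasurePreserving (fun t : ℝ => c - t) volume volume :=
    Measure.measurePreserving_sub_left volume c
  have hme : MeasurableEmbedding (fun t : ℝ => c - t) :=
    (Homeomorph.subLeft c).measurableEmbedding
  rw [← hmp.setLIntegral_comp_preimage_emb hme (fun t => ‖deriv f t‖ₑ) s]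
  refine lintegral_congr fun t => ?_
  rw [deriv_comp_const_sub, enorm_neg]

theorem le_lintegral_enorm_deriv_sublevel_left {f : ℝ → ℝ} {K : ℝ≥0} {x z μ : ℝ}
    (hf : LipschitzWith K f) (hxz : z ≤ x) (h0 : f x = 0) (hμ : 0 < μ) (hz : μ ≤ f z) :
    ENNReal.ofReal μ ≤ ∫⁻ t in Set.Icc z x ∩ {t | f t < μ}, ‖deriv f t‖ₑ := by
  rw [← lintegral_enorm_deriv_comp_neg f 0]
  have h : LipschitzWith K (fun t => f (0 - t)) := by
    refine LipschitzWith.of_dist_le_mul fun a b => ?_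
    refine (hf.dist_le_mul _ _).trans ?_
    rw [dist_sub_left]
  have := le_lintegral_enorm_deriv_sublevel h (x := -x) (z := -z) (by linarith) (by simpa) hμ
    (by simpa)
  convert this using 3
  ext t
  simp only [Set.mem_preimage, Set.mem_inter_iff, Set.mem_Icc, Set.mem_ofPred_eq]
  constructor <;> rintro ⟨⟨h1, h2⟩, h3⟩ <;> exact ⟨⟨by linarith, by linarith⟩, h3⟩

/-! ### Functions k ≥ 0 with k / sin nondecreasing on a half turn. -/

section OneSided

variable {k : ℝ → ℝ} {K : ℝ≥0}

/-- `k` restricted to `[0, π]` is sinusoidally convex from its zero at `0`. -/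
theorem lintegral_enorm_deriv_quadrant_le (hk : LipschitzWith K k) (hk0 : ∀ x, 0 ≤ k x)
    (hsub : ∀ x y, 0 ≤ x → x ≤ y → y ≤ Real.pi → k x * Real.sin y ≤ k y * Real.sin x) (μ : ℝ) :
    ∫⁻ t in Set.Icc 0 (Real.pi / 2) ∩ {t | k t < μ}, ‖deriv k t‖ₑ ≤ ENNReal.ofReal μ := by
  have hpi := Real.pi_pos
  refine lintegral_enorm_deriv_sublevel_le hk.continuous.continuousOn ?_ (hk0 0)
  intro x hx y hy hxy
  rcases eq_or_lt_of_le (hx.1.trans hxy) with h | h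
  · rw [le_antisymm (hxy.trans h.ge) hx.1, h]
  have hs : 0 < Real.sin y := Real.sin_pos_of_pos_of_lt_pi h (by linarith [hy.2])
  have h1 := hsub x y hx.1 hxy (by linarith [hy.2])
  have h2 : Real.sin x ≤ Real.sin y :=
    Real.sin_le_sin_of_le_of_le_pi_div_two (by linarith [hx.1]) hy.2 hxy
  have h3 : k x * Real.sin y ≤ k y * Real.sin y :=
    h1.trans (mul_le_mul_of_nonneg_left h2 (hk0 y))
  exact le_of_mul_le_mul_right h3 hs

/-- Beyond a quarter turn k may decrease, but k/w is still monotone as long as the sinusoid w is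
positive. In the application w is the component of c − X(s), so k + w is the height of the center,
at least δ, and w > δ/2 wherever k < δ/2. The bound for k/w is then carried over to k. -/
theorem lintegral_enorm_deriv_half_turn_le (hk : LipschitzWith K k) (hk0 : ∀ x, 0 ≤ k x)
    (hsub : ∀ x y, 0 ≤ x → x ≤ y → y ≤ Real.pi → k x * Real.sin y ≤ k y * Real.sin x)
    (h0 : k 0 = 0) {A B δ M μ : ℝ} (hδ : 0 < δ) (hM : 0 ≤ M) (hAB : A ^ 2 + B ^ 2 ≤ M ^ 2)
    (hw : ∀ φ, δ ≤ k φ + (A * Real.cos φ + B * Real.sin φ)) (hμ : μ ≤ δ / 2) :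
    ∫⁻ t in Set.Icc 0 Real.pi ∩ {t | k t < μ}, ‖deriv k t‖ₑ
      ≤ ENNReal.ofReal (2 * M / δ * (1 + Real.pi) * μ) := by
  have hpi := Real.pi_pos
  rcases (Set.Icc 0 Real.pi ∩ {t | k t < μ}).eq_empty_or_nonempty with h | hne
  · simp [h]
  set S := Set.Icc 0 Real.pi ∩ {t | k t < μ} with hS
  set w : ℝ → ℝ := fun φ => A * Real.cos φ + B * Real.sin φ with hwdef
  have hbdd : BddAbove S := ⟨Real.pi, fun t ht => ht.1.2⟩
  obtain ⟨t₀, ht₀⟩ := hne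
  have hμ0 : 0 < μ := (hk0 t₀).trans_lt ht₀.2
  have hcl : IsClosed (Set.Icc 0 Real.pi ∩ k ⁻¹' Set.Iic μ) :=
    hk.continuous.continuousOn.preimage_isClosed_of_isClosed isClosed_Icc isClosed_Iic
  have hz : sSup S ∈ Set.Icc 0 Real.pi ∩ k ⁻¹' Set.Iic μ :=
    closure_minimal (fun t (ht : t ∈ S) => Set.mem_inter ht.1 (show k t < μ from ht.2).le) hcl
      (csSup_mem_closure ⟨t₀, ht₀⟩ hbdd)
  have hsubS : S ⊆ Set.Icc 0 (sSup S) := fun t ht => ⟨ht.1.1, le_csSup hbdd ht⟩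
  set z := sSup S
  have hkz : k z ≤ μ := hz.2
  have hwz : 0 < w z := by have := hw z; simp only [hwdef]; linarith
  have hw0 : 0 < w 0 := by have := hw 0; simp only [hwdef]; linarith
  -- w(π) = −w(0), and both w(0) and w(z) are positive.
  have hzpi : z < Real.pi := by
    refine lt_of_le_of_ne hz.1.2 fun h => ?_
    rw [h] at hwz
    simp [hwdef] at hwz hw0
    linarith
  have hwid : ∀ x y, w x * Real.sin y = w 0 * Real.sin (y - x) + w y * Real.sin x := by
    intro x y
    simp only [hwdef, Real.sin_sub, Real.cos_zero, Real.sin_zero]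
    ring
  have hwpos : ∀ x ∈ Set.Icc 0 z, 0 < w x := by
    intro x hx
    rcases eq_or_lt_of_le hx.1 with h | h
    · rwa [← h]
    · have hs : 0 < Real.sin z := Real.sin_pos_of_pos_of_lt_pi (h.trans_le hx.2) hzpi
      have h1 := hwid x z
      have h2 : 0 ≤ Real.sin (z - x) :=
        Real.sin_nonneg_of_nonneg_of_le_pi (by linarith [hx.2]) (by linarith)
      have h3 : 0 < Real.sin x := Real.sin_pos_of_pos_of_lt_pi h (by linarith [hx.2])
      have : 0 < w x * Real.sin z := by rw [h1]; positivity
      exact pos_of_mul_pos_left this hs.le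
  have hwcont : Continuous w := by fun_prop
  -- k/sin is nondecreasing, and w/sin is nonincreasing by `hwid` since w(0) > 0.
  have hqm : MonotoneOn (fun x => k x / w x) (Set.Icc 0 z) := by
    intro x hx y hy hxy
    rcases eq_or_lt_of_le (hx.1.trans hxy) with h | h
    · rw [le_antisymm (hxy.trans h.ge) hx.1, h]
    have hs : 0 < Real.sin y := Real.sin_pos_of_pos_of_lt_pi h (hy.2.trans_lt hzpi)
    have h1 := hsub x y hx.1 hxy (hy.2.trans hzpi.le)
    have h2 : w y * Real.sin x ≤ w x * Real.sin y := by
      rw [hwid x y]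
      have : 0 ≤ Real.sin (y - x) :=
        Real.sin_nonneg_of_nonneg_of_le_pi (by linarith) (by linarith [hx.1, hy.2])
      nlinarith
    have hwx := hwpos x hx
    have hwy := hwpos y hy
    simp only
    rw [div_le_div_iff₀ hwx hwy]
    refine le_of_mul_le_mul_right ?_ hs
    calc k x * w y * Real.sin y = w y * (k x * Real.sin y) := by ring
      _ ≤ w y * (k y * Real.sin x) := mul_le_mul_of_nonneg_left h1 hwy.le
      _ = k y * (w y * Real.sin x) := by ring
      _ ≤ k y * (w x * Real.sin y) := mul_le_mul_of_nonneg_left h2 (hk0 y)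
      _ = _ := by ring
  have hqc : ContinuousOn (fun x => k x / w x) (Set.Icc 0 z) :=
    hk.continuous.continuousOn.div hwcont.continuousOn fun x hx => (hwpos x hx).ne'
  have hq := lintegral_enorm_deriv_sublevel_le (μ := 2 * μ / δ) hqc hqm
    (div_nonneg (hk0 0) hw0.le)
  have hwS : ∀ t ∈ S, δ / 2 < w t := by
    intro t ht
    have h1 := hw t
    have h2 : k t < μ := ht.2
    simp only [hwdef]; linarith
  have hSq : S ⊆ Set.Icc 0 z ∩ {t | k t / w t < 2 * μ / δ} := by
    intro t ht
    refine ⟨hsubS ht, ?_⟩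
    have h1 := hwS t ht
    have h2 : k t < μ := ht.2
    simp only [Set.mem_ofPred_eq]
    rw [div_lt_div_iff₀ (by linarith) hδ]
    nlinarith
  have hwM : ∀ t, |w t| ≤ M := by
    intro t
    refine abs_le_of_sq_le_sq ?_ hM
    have := Real.sin_sq_add_cos_sq t
    simp only [hwdef]
    nlinarith [sq_nonneg (A * Real.sin t - B * Real.cos t)]
  have hwM' : ∀ t, |-A * Real.sin t + B * Real.cos t| ≤ M := by
    intro t
    refine abs_le_of_sq_le_sq ?_ hM
    have := Real.sin_sq_add_cos_sq t
    nlinarith [sq_nonneg (A * Real.cos t + B * Real.sin t)]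
  have hSm : MeasurableSet S := measurableSet_Icc.inter
    (measurableSet_lt hk.continuous.measurable measurable_const)
  have hpt : ∀ᵐ t ∂volume.restrict S, ‖deriv k t‖ₑ ≤
      ENNReal.ofReal M * ‖deriv (fun x => k x / w x) t‖ₑ + ENNReal.ofReal (2 * μ / δ * M) := by
    filter_upwards [ae_restrict_of_ae hk.ae_differentiableAt_real, ae_restrict_mem hSm]
      with t hd ht
    have hwt : 0 < w t := by linarith [hwS t ht]
    have hwd : HasDerivAt w (-A * Real.sin t + B * Real.cos t) t := by
      have := ((Real.hasDerivAt_cos t).const_mul A).add ((Real.hasDerivAt_sin t).const_mul B)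
      exact this.congr_deriv (by ring)
    have hqd := (hd.hasDerivAt.fun_div hwd hwt.ne').deriv
    -- Product rule for k = (k/w)·w. The first term integrates to at most M·2μ/δ, the second is at
    -- most (2μ/δ)M on a set of length at most π.
    have hkd : deriv k t = deriv (fun x => k x / w x) t * w t
        + k t / w t * (-A * Real.sin t + B * Real.cos t) := by
      rw [hqd]
      field_simp
      ring
    have hq0 : 0 ≤ k t / w t := div_nonneg (hk0 t) hwt.le
    have hq1 : k t / w t < 2 * μ / δ := (hSq ht).2
    rw [← ofReal_norm, ← ofReal_norm, ← ENNReal.ofReal_mul hM, ← ENNReal.ofReal_add (by positivity)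
      (by positivity)]
    refine ENNReal.ofReal_le_ofReal ?_
    rw [Real.norm_eq_abs, Real.norm_eq_abs, hkd]
    refine (abs_add_le _ _).trans (add_le_add ?_ ?_)
    · rw [abs_mul, mul_comm]
      exact mul_le_mul_of_nonneg_right (hwM t) (abs_nonneg _)
    · rw [abs_mul, abs_of_nonneg hq0]
      exact mul_le_mul hq1.le (hwM' t) (abs_nonneg _) (by positivity)
  calc ∫⁻ t in S, ‖deriv k t‖ₑ
      ≤ ∫⁻ t in S, (ENNReal.ofReal M * ‖deriv (fun x => k x / w x) t‖ₑ
          + ENNReal.ofReal (2 * μ / δ * M)) := lintegral_mono_ae hpt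
    _ = ENNReal.ofReal M * (∫⁻ t in S, ‖deriv (fun x => k x / w x) t‖ₑ)
          + ENNReal.ofReal (2 * μ / δ * M) * volume S := by
        rw [lintegral_add_right _ measurable_const, lintegral_const_mul _
          (measurable_deriv _).enorm, setLIntegral_const]
    _ ≤ ENNReal.ofReal M * ENNReal.ofReal (2 * μ / δ)
          + ENNReal.ofReal (2 * μ / δ * M) * ENNReal.ofReal Real.pi := by
        gcongr
        · exact (lintegral_mono_set hSq).trans hq
        · refine (measure_mono Set.inter_subset_left).trans ?_
          rw [Real.volume_Icc, sub_zero]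
    _ = _ := by
        rw [← ENNReal.ofReal_mul hM, ← ENNReal.ofReal_mul (by positivity),
          ← ENNReal.ofReal_add (by positivity) (by positivity)]
        congr 1
        ring

end OneSided

/-! ### Radial and tangential coordinates. -/

/-- The component of `x` along `u(θ)`. -/
def radial (x : Plane) (θ : ℝ) : ℝ := x 0 * Real.cos θ + x 1 * Real.sin θ

/-- The component of `x` along `u'(θ)`. -/
def tangential (x : Plane) (θ : ℝ) : ℝ := x 1 * Real.cos θ - x 0 * Real.sin θ

theorem hasDerivAt_radial (x : Plane) (θ : ℝ) : HasDerivAt (radial x) (tangential x θ) θ := by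
  have := ((Real.hasDerivAt_cos θ).const_mul (x 0)).add ((Real.hasDerivAt_sin θ).const_mul (x 1))
  exact this.congr_deriv (by simp only [tangential]; ring)

theorem radial_sub (x y : Plane) (θ : ℝ) : radial (x - y) θ = radial x θ - radial y θ := by
  simp only [radial, PiLp.sub_apply]; ring

theorem tangential_sub (x y : Plane) (θ : ℝ) :
    tangential (x - y) θ = tangential x θ - tangential y θ := by
  simp only [tangential, PiLp.sub_apply]; ring

theorem norm_sq_plane (x : Plane) : ‖x‖ ^ 2 = x 0 ^ 2 + x 1 ^ 2 := by
  rw [EuclideanSpace.norm_sq_eq]; simp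

theorem radial_sq_add_tangential_sq (x : Plane) (θ : ℝ) :
    radial x θ ^ 2 + tangential x θ ^ 2 = ‖x‖ ^ 2 := by
  rw [norm_sq_plane]
  simp only [radial, tangential]
  have := Real.sin_sq_add_cos_sq θ
  linear_combination (x 0 ^ 2 + x 1 ^ 2) * this

theorem abs_radial_le (x : Plane) (θ : ℝ) : |radial x θ| ≤ ‖x‖ :=
  abs_le_of_sq_le_sq (by nlinarith [radial_sq_add_tangential_sq x θ]) (norm_nonneg x)

theorem abs_tangential_le (x : Plane) (θ : ℝ) : |tangential x θ| ≤ ‖x‖ :=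
  abs_le_of_sq_le_sq (by nlinarith [radial_sq_add_tangential_sq x θ]) (norm_nonneg x)

theorem radial_add_two_pi (x : Plane) (θ : ℝ) : radial x (θ + 2 * Real.pi) = radial x θ := by
  simp [radial]

theorem radial_add_angle (x : Plane) (θ φ : ℝ) :
    radial x (θ + φ) = radial x θ * Real.cos φ + tangential x θ * Real.sin φ := by
  simp only [radial, tangential, Real.cos_add, Real.sin_add]; ring

/-- The equality case of the field `concave` of `IsSupportedCurve`; subtracting one from the other
gives the convexity of the height. -/
theorem radial_mul_sin (x : Plane) (θ₁ θ₂ θ₃ : ℝ) :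
    radial x θ₂ * Real.sin (θ₃ - θ₁)
      = radial x θ₁ * Real.sin (θ₃ - θ₂) + radial x θ₃ * Real.sin (θ₂ - θ₁) := by
  obtain ⟨p, rfl⟩ : ∃ p, θ₂ = θ₁ + p := ⟨θ₂ - θ₁, by ring⟩
  obtain ⟨q, rfl⟩ : ∃ q, θ₃ = θ₁ + p + q := ⟨θ₃ - (θ₁ + p), by ring⟩
  rw [show θ₁ + p + q - θ₁ = p + q by ring, show θ₁ + p + q - (θ₁ + p) = q by ring,
    show θ₁ + p - θ₁ = p by ring, add_assoc, radial_add_angle, radial_add_angle, Real.sin_add,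
    Real.cos_add]
  have := Real.sin_sq_add_cos_sq p
  linear_combination (radial x θ₁ * Real.sin q) * this

theorem hasDerivAt_coord {X : ℝ → Plane} {T : Plane} {s : ℝ} (hX : HasDerivAt X T s) (i : Fin 2) :
    HasDerivAt (fun r => X r i) (T i) s :=
  (EuclideanSpace.proj i : Plane →L[ℝ] ℝ).hasFDerivAt.comp_hasDerivAt s hX

theorem hasDerivAt_radial_comp {X : ℝ → Plane} {T : Plane} {s : ℝ} (hX : HasDerivAt X T s)
    (θ : ℝ) : HasDerivAt (fun r => radial (X r) θ) (radial T θ) s :=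
  ((hasDerivAt_coord hX 0).mul_const _).add ((hasDerivAt_coord hX 1).mul_const _)

theorem hasDerivAt_tangential_comp {X : ℝ → Plane} {T : Plane} {s : ℝ} (hX : HasDerivAt X T s)
    (θ : ℝ) : HasDerivAt (fun r => tangential (X r) θ) (tangential T θ) s :=
  ((hasDerivAt_coord hX 1).mul_const _).sub ((hasDerivAt_coord hX 0).mul_const _)

theorem lipschitzWith_radial (x : Plane) : LipschitzWith ‖x‖₊ (radial x) := by
  refine lipschitzWith_of_nnnorm_deriv_le (fun θ => (hasDerivAt_radial x θ).differentiableAt) ?_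
  intro θ
  rw [(hasDerivAt_radial x θ).deriv, ← NNReal.coe_le_coe, coe_nnnorm, coe_nnnorm]
  exact abs_tangential_le x θ

/-! ### Curves with a support function, and the height at a fixed point as the direction varies. -/

/-- A closed curve of unit speed around `c`, run through counterclockwise, together with a function
`h` which is the support function of a convex set having the curve as its boundary. -/
structure IsSupportedCurve (X : ℝ → Plane) (h : ℝ → ℝ) (c : Plane) (δ M : ℝ) : Prop where
  pos : 0 < δ
  lipschitz : LipschitzWith 1 X
  speed : ∀ᵐ s, ‖deriv X s‖ = 1
  orient : ∀ᵐ s, 0 ≤ (X s - c) 0 * (deriv X s) 1 - (X s - c) 1 * (deriv X s) 0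
  periodic : ∀ θ, h (θ + 2 * Real.pi) = h θ
  lipschitz_support : ∃ K, LipschitzWith K h
  le_radial : ∀ s θ, h θ ≤ radial (X s) θ
  touch : ∀ s, ∃ θ, h θ = radial (X s) θ
  concave : ∀ x y z, x ≤ y → y ≤ z → z ≤ x + Real.pi →
    h x * Real.sin (z - y) + h z * Real.sin (y - x) ≤ h y * Real.sin (z - x)
  deep : ∀ θ, h θ + δ ≤ radial c θ
  bounded : ∀ s, ‖X s - c‖ ≤ M

/-- The height of the point `X s` over the supporting line in direction `θ`. -/
def height (X : ℝ → Plane) (h : ℝ → ℝ) (s θ : ℝ) : ℝ := radial (X s) θ - h θ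

/-- The density, in `ds dθ`, of the area swept by the chords (divided by their distance). -/
def density (X : ℝ → Plane) (h : ℝ → ℝ) (s θ : ℝ) : ℝ :=
  |tangential (X s) θ - deriv h θ| * -tangential (deriv X s) θ

theorem setLIntegral_Icc_le_of_periodic {f : ℝ → ℝ≥0∞} (hf : ∀ x, f (x + 2 * Real.pi) = f x)
    {a b : ℝ} (hb : b ≤ a + 2 * Real.pi) (c : ℝ) :
    ∫⁻ t in Set.Icc a b, f t ≤ ∫⁻ t in Set.Icc (c - Real.pi) (c + Real.pi), f t := by
  have h2 : (0 : ℝ) < 2 * Real.pi := by positivity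
  calc ∫⁻ t in Set.Icc a b, f t ≤ ∫⁻ t in Set.Icc a (a + 2 * Real.pi), f t :=
        lintegral_mono_set (Set.Icc_subset_Icc_right hb)
    _ = ∫⁻ t in Set.Ioc a (a + 2 * Real.pi), f t := by rw [restrict_Ioc_eq_restrict_Icc]
    _ = ∫⁻ t in Set.Ioc (c - Real.pi) (c - Real.pi + 2 * Real.pi), f t := by
        refine (isAddFundamentalDomain_Ioc h2 a).setLIntegral_eq
          (isAddFundamentalDomain_Ioc h2 (c - Real.pi)) f ?_
        rintro ⟨g, hg⟩ x
        obtain ⟨n, rfl⟩ := AddSubgroup.mem_zmultiples_iff.mp hg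
        have hp : Function.Periodic f (2 * Real.pi) := hf
        have := hp.zsmul n x
        rw [add_comm] at this
        exact this
    _ = _ := by
        rw [restrict_Ioc_eq_restrict_Icc]
        congr 3
        ring

namespace IsSupportedCurve

variable {X : ℝ → Plane} {h : ℝ → ℝ} {c : Plane} {δ M : ℝ}

theorem height_nonneg (H : IsSupportedCurve X h c δ M) (s θ : ℝ) : 0 ≤ height X h s θ :=
  sub_nonneg.mpr (H.le_radial s θ)

theorem bound_nonneg (H : IsSupportedCurve X h c δ M) : 0 ≤ M :=
  (norm_nonneg _).trans (H.bounded 0)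

theorem height_add_two_pi (H : IsSupportedCurve X h c δ M) (s θ : ℝ) :
    height X h s (θ + 2 * Real.pi) = height X h s θ := by
  simp only [height, radial_add_two_pi, H.periodic]

theorem lipschitz_height (H : IsSupportedCurve X h c δ M) (s : ℝ) :
    ∃ K, LipschitzWith K (height X h s) := by
  obtain ⟨K, hK⟩ := H.lipschitz_support
  exact ⟨_, (lipschitzWith_radial (X s)).sub hK⟩

theorem deriv_height (H : IsSupportedCurve X h c δ M) :
    ∀ᵐ θ, ∀ s, deriv (height X h s) θ = tangential (X s) θ - deriv h θ := by
  obtain ⟨K, hK⟩ := H.lipschitz_support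
  filter_upwards [hK.ae_differentiableAt_real] with θ hθ s
  exact ((hasDerivAt_radial (X s) θ).sub hθ.hasDerivAt).deriv

/-- At almost every point of the curve the normal direction is unique and orthogonal to the
velocity. -/
theorem neg_tangential_deriv (H : IsSupportedCurve X h c δ M) :
    ∀ᵐ s, ∀ θ₀, height X h s θ₀ = 0 →
      ∀ θ, -tangential (deriv X s) θ = Real.cos (θ - θ₀) := by
  filter_upwards [H.lipschitz.ae_differentiableAt_real, H.speed, H.orient] with s hd hs ho θ₀ h0 θ
  have hd0 := hd.hasDerivAt
  have hr := hasDerivAt_radial_comp hd0 θ₀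
  -- The curve stays above the supporting line that it meets at s, so its velocity there is parallel
  -- to that line.
  have hmin : IsLocalMin (fun r => radial (X r) θ₀) s := by
    refine Filter.Eventually.of_forall fun r => ?_
    have h1 := H.le_radial r θ₀
    simp only [height] at h0
    linarith
  have hT : radial (deriv X s) θ₀ = 0 := hmin.hasDerivAt_eq_zero hr
  have hn := radial_sq_add_tangential_sq (deriv X s) θ₀
  have hx : radial (X s - c) θ₀ < 0 := by
    rw [radial_sub]
    have := H.deep θ₀
    have := H.pos
    simp only [height] at h0
    linarith
  have hcr : (X s - c) 0 * (deriv X s) 1 - (X s - c) 1 * (deriv X s) 0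
      = radial (X s - c) θ₀ * tangential (deriv X s) θ₀
        - tangential (X s - c) θ₀ * radial (deriv X s) θ₀ := by
    have := Real.sin_sq_add_cos_sq θ₀
    simp only [radial, tangential]
    linear_combination (-((X s - c) 0 * (deriv X s) 1 - (X s - c) 1 * (deriv X s) 0)) * this
  rw [hcr, hT] at ho
  rw [hT, hs] at hn
  -- Unit speed leaves ±1; the counterclockwise orientation around a center above the line selects
  -- −1.
  have hσ : tangential (deriv X s) θ₀ = -1 := by
    have h1 : tangential (deriv X s) θ₀ ≤ 0 := by
      by_contra hcon
      push Not at hcon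
      nlinarith [mul_pos_of_neg_of_neg hx (neg_lt_zero.mpr hcon)]
    nlinarith
  have key : tangential (deriv X s) θ = tangential (deriv X s) θ₀ * Real.cos (θ - θ₀)
      - radial (deriv X s) θ₀ * Real.sin (θ - θ₀) := by
    simp only [radial, tangential, Real.cos_sub, Real.sin_sub]
    have := Real.sin_sq_add_cos_sq θ₀
    linear_combination (-(deriv X s 1 * Real.cos θ - deriv X s 0 * Real.sin θ)) * this
  rw [key, hσ, hT]
  ring

/-- The sharp bound on the half circle around the normal serves the positive part of the density.
The bound on the full circle serves the negative part, where only the order in μ matters. Each side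
of θ₀ is reduced to a one-sided estimate by a translation or a reflection. -/
theorem lintegral_deriv_height_sublevel_le (H : IsSupportedCurve X h c δ M) {s θ₀ : ℝ}
    (h0 : height X h s θ₀ = 0) (μ : ℝ) :
    (∫⁻ θ in Set.Icc (θ₀ - Real.pi / 2) (θ₀ + Real.pi / 2) ∩ {θ | height X h s θ < μ},
        ‖deriv (height X h s) θ‖ₑ ≤ 2 * ENNReal.ofReal μ) ∧
      (μ ≤ δ / 2 → ∫⁻ θ in Set.Icc (θ₀ - Real.pi) (θ₀ + Real.pi) ∩ {θ | height X h s θ < μ},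
        ‖deriv (height X h s) θ‖ₑ ≤ 2 * ENNReal.ofReal (2 * M / δ * (1 + Real.pi) * μ)) := by
  obtain ⟨K, hK⟩ := H.lipschitz_height s
  set k := height X h s with hk
  have hpi := Real.pi_pos
  have hAB : radial (c - X s) θ₀ ^ 2 + tangential (c - X s) θ₀ ^ 2 ≤ M ^ 2 := by
    rw [radial_sq_add_tangential_sq]
    have := H.bounded s
    rw [norm_sub_rev] at this
    gcongr
  have hwr : ∀ φ, δ ≤ k (θ₀ + φ) + (radial (c - X s) θ₀ * Real.cos φ
      + tangential (c - X s) θ₀ * Real.sin φ) := by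
    intro φ
    rw [← radial_add_angle, radial_sub]
    have := H.deep (θ₀ + φ)
    simp only [hk, height]
    linarith
  have hlr : LipschitzWith K (fun φ => k (θ₀ + φ)) := fun x y => by
    simpa using hK (θ₀ + x) (θ₀ + y)
  have hll : LipschitzWith K (fun φ => k (θ₀ - φ)) := fun x y => by
    simpa using hK (θ₀ - x) (θ₀ - y)
  -- In the difference of `radial_mul_sin` and `concave` the term at θ₀ drops out, since the height
  -- vanishes there.
  have hsr : ∀ x y, 0 ≤ x → x ≤ y → y ≤ Real.pi →
      k (θ₀ + x) * Real.sin y ≤ k (θ₀ + y) * Real.sin x := by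
    intro x y hx hxy hy
    have h1 := H.concave θ₀ (θ₀ + x) (θ₀ + y) (by linarith) (by linarith) (by linarith)
    have h2 := radial_mul_sin (X s) θ₀ (θ₀ + x) (θ₀ + y)
    simp only [add_sub_cancel_left, show θ₀ + y - (θ₀ + x) = y - x by ring] at h1 h2
    simp only [hk, height] at h0 ⊢
    have h3 : radial (X s) θ₀ = h θ₀ := by linarith
    rw [h3] at h2
    linarith
  have hsl : ∀ x y, 0 ≤ x → x ≤ y → y ≤ Real.pi →
      k (θ₀ - x) * Real.sin y ≤ k (θ₀ - y) * Real.sin x := by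
    intro x y hx hxy hy
    have h1 := H.concave (θ₀ - y) (θ₀ - x) θ₀ (by linarith) (by linarith) (by linarith)
    have h2 := radial_mul_sin (X s) (θ₀ - y) (θ₀ - x) θ₀
    simp only [sub_sub_cancel, show θ₀ - x - (θ₀ - y) = y - x by ring] at h1 h2
    simp only [hk, height] at h0 ⊢
    have h3 : radial (X s) θ₀ = h θ₀ := by linarith
    rw [h3] at h2
    linarith
  have shift_right : ∀ r, ∫⁻ θ in Set.Icc θ₀ (θ₀ + r) ∩ {θ | k θ < μ}, ‖deriv k θ‖ₑ
      = ∫⁻ φ in Set.Icc 0 r ∩ {φ | k (θ₀ + φ) < μ}, ‖deriv (fun φ => k (θ₀ + φ)) φ‖ₑ := by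
    intro r
    have hmp : MeasurePreserving (fun t : ℝ => θ₀ + t) volume volume :=
      measurePreserving_add_left volume θ₀
    rw [← hmp.setLIntegral_comp_preimage_emb (measurableEmbedding_addLeft θ₀)
      (fun θ => ‖deriv k θ‖ₑ)]
    have hset : (fun t : ℝ => θ₀ + t) ⁻¹' (Set.Icc θ₀ (θ₀ + r) ∩ {θ | k θ < μ})
        = Set.Icc 0 r ∩ {φ | k (θ₀ + φ) < μ} := by
      ext t
      simp
    rw [hset]
    refine lintegral_congr fun t => ?_
    rw [deriv_comp_const_add]
  have shift_left : ∀ r, ∫⁻ θ in Set.Icc (θ₀ - r) θ₀ ∩ {θ | k θ < μ}, ‖deriv k θ‖ₑ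
      = ∫⁻ φ in Set.Icc 0 r ∩ {φ | k (θ₀ - φ) < μ}, ‖deriv (fun φ => k (θ₀ - φ)) φ‖ₑ := by
    intro r
    rw [← lintegral_enorm_deriv_comp_neg k θ₀]
    congr 2
    ext t
    simp [and_comm]
  have split : ∀ r, 0 ≤ r → ∫⁻ θ in Set.Icc (θ₀ - r) (θ₀ + r) ∩ {θ | k θ < μ}, ‖deriv k θ‖ₑ
      ≤ (∫⁻ θ in Set.Icc (θ₀ - r) θ₀ ∩ {θ | k θ < μ}, ‖deriv k θ‖ₑ)
        + ∫⁻ θ in Set.Icc θ₀ (θ₀ + r) ∩ {θ | k θ < μ}, ‖deriv k θ‖ₑ := by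
    intro r hr
    refine le_trans (lintegral_mono_set ?_) (lintegral_union_le _ _ _)
    rw [← Set.union_inter_distrib_right, Set.Icc_union_Icc_eq_Icc (by linarith) (by linarith)]
  have k0 : ∀ θ, 0 ≤ k θ := H.height_nonneg s
  constructor
  · refine (split _ (by positivity)).trans ?_
    rw [shift_left, shift_right, two_mul]
    exact add_le_add (lintegral_enorm_deriv_quadrant_le hll (fun _ => k0 _) hsl μ)
      (lintegral_enorm_deriv_quadrant_le hlr (fun _ => k0 _) hsr μ)
  · intro hμ
    refine (split _ (by positivity)).trans ?_
    rw [shift_left, shift_right, two_mul]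
    refine add_le_add
      (lintegral_enorm_deriv_half_turn_le (A := radial (c - X s) θ₀)
        (B := -tangential (c - X s) θ₀) hll (fun _ => k0 _) hsl (by simpa using h0) H.pos
        H.bound_nonneg (by simpa using hAB) ?_ hμ)
      (lintegral_enorm_deriv_half_turn_le hlr (fun _ => k0 _) hsr (by simpa using h0) H.pos
        H.bound_nonneg hAB hwr hμ)
    intro φ
    have := hwr (-φ)
    rw [Real.cos_neg, Real.sin_neg, ← sub_eq_add_neg] at this
    linarith

end IsSupportedCurve

/-! ### Contribution of a single boundary point to the swept density. -/

/-- The integral over `θ ∈ [a, b]` of the positive part of the swept density at the point `X s`,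
over the directions in which that point lies in the cap of height `lam`. -/
def posSweep (X : ℝ → Plane) (h : ℝ → ℝ) (a b lam s : ℝ) : ℝ≥0∞ :=
  ∫⁻ θ in Set.Icc a b, {p : ℝ × ℝ | height X h p.1 p.2 < lam}.indicator
    (fun p => ENNReal.ofReal (density X h p.1 p.2)) (s, θ)

/-- The analogue of `posSweep` for the negative part of the swept density. -/
def negSweep (X : ℝ → Plane) (h : ℝ → ℝ) (a b lam s : ℝ) : ℝ≥0∞ :=
  ∫⁻ θ in Set.Icc a b, {p : ℝ × ℝ | height X h p.1 p.2 < lam}.indicator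
    (fun p => ENNReal.ofReal (-density X h p.1 p.2)) (s, θ)

/-- The parameters of the points whose height is less than `lam` for some direction in
`[a, b]`. -/
def lowSet (X : ℝ → Plane) (h : ℝ → ℝ) (a b lam : ℝ) : Set ℝ :=
  {s | ∃ θ ∈ Set.Icc a b, height X h s θ < lam}

/-- The parameters of the points that touch a supporting line with direction in `[a, b]`. -/
def touchSet (X : ℝ → Plane) (h : ℝ → ℝ) (a b : ℝ) : Set ℝ :=
  {s | ∃ θ ∈ Set.Icc a b, height X h s θ = 0}

theorem exists_pos_le_of_isCompact {k : ℝ → ℝ} {A : Set ℝ} (hA : IsCompact A) (hk : Continuous k)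
    (hpos : ∀ x ∈ A, 0 < k x) : ∃ lam₀, 0 < lam₀ ∧ ∀ x ∈ A, lam₀ ≤ k x := by
  rcases A.eq_empty_or_nonempty with rfl | hne
  · exact ⟨1, one_pos, by simp⟩
  · obtain ⟨x, hx, hmin⟩ := hA.exists_isMinOn hne hk.continuousOn
    exact ⟨k x, hpos x hx, fun y hy => hmin hy⟩

theorem eventually_inv_le {lam₀ : ℝ} (h : 0 < lam₀) : ∀ᶠ ρ : ℝ in atTop, 0 < ρ ∧ ρ⁻¹ ≤ lam₀ := by
  filter_upwards [eventually_gt_atTop 0, tendsto_inv_atTop_zero.eventually (gt_mem_nhds h)]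
    with ρ h1 h2
  exact ⟨h1, le_of_lt h2⟩

namespace IsSupportedCurve

variable {X : ℝ → Plane} {h : ℝ → ℝ} {c : Plane} {δ M : ℝ}

theorem continuous_height (H : IsSupportedCurve X h c δ M) :
    Continuous fun p : ℝ × ℝ => height X h p.1 p.2 := by
  obtain ⟨K, hK⟩ := H.lipschitz_support
  have h1 := hK.continuous
  have h2 := H.lipschitz.continuous
  unfold height radial
  fun_prop

theorem measurable_density (H : IsSupportedCurve X h c δ M) :
    Measurable fun p : ℝ × ℝ => density X h p.1 p.2 := by
  have h1 := measurable_deriv h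
  have h2 := H.lipschitz.continuous
  have h3 := measurable_deriv X
  have h4 : ∀ i, Measurable fun s => deriv X s i := fun i =>
    (EuclideanSpace.proj i : Plane →L[ℝ] ℝ).continuous.measurable.comp h3
  have h5 := h4 0
  have h6 := h4 1
  have h7 : Measurable fun p : ℝ × ℝ => tangential (X p.1) p.2 := by
    refine Continuous.measurable ?_
    unfold tangential
    fun_prop
  unfold density
  refine Measurable.mul ?_ ?_
  · exact (h7.sub (h1.comp measurable_snd)).norm
  · unfold tangential
    fun_prop

theorem measurableSet_height_lt (H : IsSupportedCurve X h c δ M) (lam : ℝ) :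
    MeasurableSet {p : ℝ × ℝ | height X h p.1 p.2 < lam} :=
  (isOpen_lt H.continuous_height continuous_const).measurableSet

theorem measurable_posIntegrand (H : IsSupportedCurve X h c δ M) (lam : ℝ) :
    Measurable ({p : ℝ × ℝ | height X h p.1 p.2 < lam}.indicator
      (fun p => ENNReal.ofReal (density X h p.1 p.2))) :=
  H.measurable_density.ennreal_ofReal.indicator (H.measurableSet_height_lt lam)

theorem measurable_negIntegrand (H : IsSupportedCurve X h c δ M) (lam : ℝ) :
    Measurable ({p : ℝ × ℝ | height X h p.1 p.2 < lam}.indicator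
      (fun p => ENNReal.ofReal (-density X h p.1 p.2))) :=
  H.measurable_density.neg.ennreal_ofReal.indicator (H.measurableSet_height_lt lam)

theorem measurable_posSweep (H : IsSupportedCurve X h c δ M) (a b lam : ℝ) :
    Measurable (posSweep X h a b lam) :=
  (H.measurable_posIntegrand lam).lintegral_prod_right'

theorem measurable_negSweep (H : IsSupportedCurve X h c δ M) (a b lam : ℝ) :
    Measurable (negSweep X h a b lam) :=
  (H.measurable_negIntegrand lam).lintegral_prod_right'

theorem continuous_height_right (H : IsSupportedCurve X h c δ M) (s : ℝ) :
    Continuous (height X h s) :=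
  H.continuous_height.comp (by fun_prop : Continuous fun θ : ℝ => (s, θ))

theorem measurableSet_section (H : IsSupportedCurve X h c δ M) (s lam : ℝ) :
    MeasurableSet {θ | height X h s θ < lam} :=
  (isOpen_lt (H.continuous_height_right s) continuous_const).measurableSet

theorem sweep_eq (H : IsSupportedCurve X h c δ M) (a b lam s : ℝ) (g : ℝ × ℝ → ℝ≥0∞) :
    ∫⁻ θ in Set.Icc a b, {p : ℝ × ℝ | height X h p.1 p.2 < lam}.indicator g (s, θ)
      = ∫⁻ θ in Set.Icc a b ∩ {θ | height X h s θ < lam}, g (s, θ) := by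
  rw [Set.inter_comm, ← setLIntegral_indicator (H.measurableSet_section s lam)]
  rfl

theorem isOpen_lowSet (H : IsSupportedCurve X h c δ M) (a b lam : ℝ) :
    IsOpen (lowSet X h a b lam) := by
  have : lowSet X h a b lam = ⋃ θ ∈ Set.Icc a b, {s | height X h s θ < lam} := by
    ext s; simp [lowSet]
  rw [this]
  refine isOpen_biUnion fun θ _ => isOpen_lt ?_ continuous_const
  exact H.continuous_height.comp (by fun_prop : Continuous fun s : ℝ => (s, θ))

theorem touchSet_subset_lowSet {a b lam : ℝ} (hlam : 0 < lam) :
    touchSet X h a b ⊆ lowSet X h a b lam := by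
  rintro s ⟨θ, hθ, h0⟩
  exact ⟨θ, hθ, by rwa [h0]⟩

/-- By compactness of [a, b], a height that is positive throughout has a positive minimum. -/
theorem exists_notMem_lowSet (H : IsSupportedCurve X h c δ M) {a b s : ℝ}
    (hs : s ∉ touchSet X h a b) : ∃ lam₀, 0 < lam₀ ∧ ∀ lam ≤ lam₀, s ∉ lowSet X h a b lam := by
  obtain ⟨lam₀, h1, h2⟩ := exists_pos_le_of_isCompact (isCompact_Icc (a := a) (b := b))
    (H.continuous_height_right s)
    fun θ hθ => lt_of_le_of_ne (H.height_nonneg s θ) fun h => hs ⟨θ, hθ, h.symm⟩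
  refine ⟨lam₀, h1, ?_⟩
  rintro lam hlam ⟨θ, hθ, hlt⟩
  exact absurd (h2 θ hθ) (not_le.mpr (hlt.trans_le hlam))

theorem measurableSet_touchSet (H : IsSupportedCurve X h c δ M) (a b : ℝ) :
    MeasurableSet (touchSet X h a b) := by
  have : touchSet X h a b = ⋂ n : ℕ, lowSet X h a b (1 / ((n : ℝ) + 1)) := by
    refine Set.Subset.antisymm
      (Set.subset_iInter fun n => touchSet_subset_lowSet (by positivity)) ?_
    intro s hs
    by_contra hcon
    obtain ⟨lam₀, h1, h2⟩ := H.exists_notMem_lowSet hcon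
    obtain ⟨n, hn⟩ := exists_nat_one_div_lt h1
    exact h2 _ hn.le (Set.mem_iInter.mp hs n)
  rw [this]
  exact MeasurableSet.iInter fun n => (H.isOpen_lowSet a b _).measurableSet

theorem deriv_height_add_two_pi (H : IsSupportedCurve X h c δ M) (s θ : ℝ) :
    deriv (height X h s) (θ + 2 * Real.pi) = deriv (height X h s) θ := by
  rw [← deriv_comp_add_const]
  congr 1
  ext θ
  exact H.height_add_two_pi s θ

theorem sweep_eq_zero (H : IsSupportedCurve X h c δ M) {a b lam s : ℝ} (g : ℝ × ℝ → ℝ≥0∞)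
    (hs : s ∉ lowSet X h a b lam) :
    ∫⁻ θ in Set.Icc a b, {p : ℝ × ℝ | height X h p.1 p.2 < lam}.indicator g (s, θ) = 0 := by
  have : Set.Icc a b ∩ {θ | height X h s θ < lam} = ∅ := by
    ext θ
    simp only [Set.mem_inter_iff, Set.mem_empty_iff_false, iff_false]
    exact fun hθ => hs ⟨θ, hθ.1, hθ.2⟩
  rw [H.sweep_eq, this]
  simp

theorem density_eq (H : IsSupportedCurve X h c δ M) :
    ∀ᵐ s, ∀ θ₀, height X h s θ₀ = 0 → ∀ᵐ θ,
      density X h s θ = |deriv (height X h s) θ| * Real.cos (θ - θ₀) := by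
  filter_upwards [H.neg_tangential_deriv] with s hs θ₀ h0
  filter_upwards [H.deriv_height] with θ hθ
  rw [density, hs θ₀ h0 θ, hθ]

/-- Only directions with cos(θ − θ₀) > 0 count, that is, those within a quarter turn of the normal;
the two sides give lam each. -/
theorem posSweep_le (H : IsSupportedCurve X h c δ M) {a b : ℝ} (hb : b ≤ a + 2 * Real.pi) :
    ∀ᵐ s, ∀ lam, posSweep X h a b lam s
      ≤ (lowSet X h a b lam).indicator (fun _ => 2 * ENNReal.ofReal lam) s := by
  filter_upwards [H.density_eq] with s hs lam
  by_cases hlow : s ∈ lowSet X h a b lam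
  swap
  · rw [Set.indicator_of_notMem hlow, posSweep, H.sweep_eq_zero _ hlow]
  rw [Set.indicator_of_mem hlow, posSweep]
  obtain ⟨θ₀, h0⟩ := H.touch s
  replace h0 : height X h s θ₀ = 0 := by rw [height, h0, sub_self]
  -- A periodic majorant, so that [a, b] can be replaced by the full turn centered at θ₀.
  set f : ℝ → ℝ≥0∞ := {θ | height X h s θ < lam ∧ 0 ≤ Real.cos (θ - θ₀)}.indicator
    (fun θ => ‖deriv (height X h s) θ‖ₑ) with hf
  have hfper : ∀ θ, f (θ + 2 * Real.pi) = f θ := by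
    intro θ
    have h1 : Real.cos (θ + 2 * Real.pi - θ₀) = Real.cos (θ - θ₀) := by
      rw [show θ + 2 * Real.pi - θ₀ = θ - θ₀ + 2 * Real.pi by ring, Real.cos_add_two_pi]
    simp only [hf, Set.indicator, Set.mem_ofPred_eq, H.height_add_two_pi,
      H.deriv_height_add_two_pi, h1]
    split_ifs <;> rfl
  have hle : ∫⁻ θ in Set.Icc a b, {p : ℝ × ℝ | height X h p.1 p.2 < lam}.indicator
      (fun p => ENNReal.ofReal (density X h p.1 p.2)) (s, θ) ≤ ∫⁻ θ in Set.Icc a b, f θ := by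
    refine lintegral_mono_ae (ae_restrict_of_ae ?_)
    filter_upwards [hs θ₀ h0] with θ hθ
    by_cases h1 : height X h s θ < lam
    · rw [Set.indicator_of_mem (by exact h1)]
      simp only [hθ]
      by_cases h2 : 0 ≤ Real.cos (θ - θ₀)
      · rw [hf, Set.indicator_of_mem (by exact ⟨h1, h2⟩), ← ofReal_norm, Real.norm_eq_abs]
        exact ENNReal.ofReal_le_ofReal
          (mul_le_of_le_one_right (abs_nonneg _) (Real.cos_le_one _))
      · rw [ENNReal.ofReal_of_nonpos]
        · exact zero_le
        · exact mul_nonpos_of_nonneg_of_nonpos (abs_nonneg _) (not_le.mp h2).le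
    · rw [Set.indicator_of_notMem (by exact h1)]
      exact zero_le
  refine hle.trans ((setLIntegral_Icc_le_of_periodic hfper hb θ₀).trans ?_)
  refine le_trans ?_ (H.lintegral_deriv_height_sublevel_le h0 lam).1
  have hm : MeasurableSet {θ | height X h s θ < lam ∧ 0 ≤ Real.cos (θ - θ₀)} :=
    (H.measurableSet_section s lam).inter
      (isClosed_le (f := fun _ => (0 : ℝ)) (g := fun θ => Real.cos (θ - θ₀)) continuous_const
        (by fun_prop)).measurableSet
  rw [hf, setLIntegral_indicator hm]
  refine lintegral_mono_set ?_
  rintro θ ⟨⟨h1, h2⟩, h3⟩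
  refine ⟨?_, h1⟩
  have hpi := Real.pi_pos
  constructor
  · by_contra hcon
    push Not at hcon
    have := Real.cos_neg_of_pi_div_two_lt_of_lt (x := θ₀ - θ) (by linarith) (by linarith [h3.1])
    rw [← neg_sub, Real.cos_neg] at this
    linarith
  · by_contra hcon
    push Not at hcon
    have := Real.cos_neg_of_pi_div_two_lt_of_lt (x := θ - θ₀) (by linarith) (by linarith [h3.2])
    linarith

/-- A crude bound of order lam, whose purpose is to dominate ρ·`negSweep` uniformly in ρ. -/
theorem negSweep_le (H : IsSupportedCurve X h c δ M) {a b : ℝ} (hb : b ≤ a + 2 * Real.pi) :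
    ∀ᵐ s, ∀ lam ≤ δ / 2, negSweep X h a b lam s
      ≤ 2 * ENNReal.ofReal (2 * M / δ * (1 + Real.pi) * lam) := by
  filter_upwards [H.density_eq] with s hs lam hlam
  rw [negSweep]
  obtain ⟨θ₀, h0⟩ := H.touch s
  replace h0 : height X h s θ₀ = 0 := by rw [height, h0, sub_self]
  set f : ℝ → ℝ≥0∞ := {θ | height X h s θ < lam}.indicator
    (fun θ => ‖deriv (height X h s) θ‖ₑ) with hf
  have hfper : ∀ θ, f (θ + 2 * Real.pi) = f θ := by
    intro θ
    simp only [hf, Set.indicator, Set.mem_ofPred_eq, H.height_add_two_pi,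
      H.deriv_height_add_two_pi]
  have hle : ∫⁻ θ in Set.Icc a b, {p : ℝ × ℝ | height X h p.1 p.2 < lam}.indicator
      (fun p => ENNReal.ofReal (-density X h p.1 p.2)) (s, θ) ≤ ∫⁻ θ in Set.Icc a b, f θ := by
    refine lintegral_mono_ae (ae_restrict_of_ae ?_)
    filter_upwards [hs θ₀ h0] with θ hθ
    by_cases h1 : height X h s θ < lam
    · rw [Set.indicator_of_mem (by exact h1), hf, Set.indicator_of_mem (by exact h1), ← ofReal_norm,
        Real.norm_eq_abs]
      simp only [hθ]
      refine ENNReal.ofReal_le_ofReal ?_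
      rw [← mul_neg]
      exact mul_le_of_le_one_right (abs_nonneg _) (by linarith [Real.neg_one_le_cos (θ - θ₀)])
    · rw [Set.indicator_of_notMem (by exact h1)]
      exact zero_le
  refine hle.trans ((setLIntegral_Icc_le_of_periodic hfper hb θ₀).trans ?_)
  rw [hf, setLIntegral_indicator (H.measurableSet_section s lam), Set.inter_comm]
  exact (H.lintegral_deriv_height_sublevel_le h0 lam).2 hlam

/-- The normal direction is unique at almost every point. -/
theorem cos_eq_one_of_height_eq_zero (H : IsSupportedCurve X h c δ M) :
    ∀ᵐ s, ∀ θ₀ θ₁, height X h s θ₀ = 0 → height X h s θ₁ = 0 → Real.cos (θ₁ - θ₀) = 1 := by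
  filter_upwards [H.neg_tangential_deriv] with s hs θ₀ θ₁ h0 h1
  rw [← hs θ₀ h0, hs θ₁ h1, sub_self, Real.cos_zero]

theorem eventually_le_posSweep (H : IsSupportedCurve X h c δ M) {a b : ℝ} (hab : a < b)
    (hb : b ≤ a + 2 * Real.pi) :
    ∀ᵐ s, s ∈ touchSet X h a b → ∀ ε, 0 < ε → ε < 1 → ∃ lam₀, 0 < lam₀ ∧ ∀ lam, 0 < lam →
      lam ≤ lam₀ → ENNReal.ofReal ((1 - ε) * lam) ≤ posSweep X h a b lam s
        ∧ negSweep X h a b lam s = 0 := by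
  filter_upwards [H.density_eq, H.cos_eq_one_of_height_eq_zero] with s hs hu hts ε hε hε1
  obtain ⟨θ₁, hθ₁, h1⟩ := hts
  obtain ⟨K, hK⟩ := H.lipschitz_height s
  have hpi := Real.pi_pos
  -- The normal is unique only modulo 2π, so z must differ from θ₁ by less than 2π: the midpoint
  -- will do, or a if θ₁ is the midpoint.
  obtain ⟨z, hz, hzpos⟩ : ∃ z ∈ Set.Icc a b, 0 < height X h s z := by
    have key : ∀ z, z ≠ θ₁ → |z - θ₁| < 2 * Real.pi → 0 < height X h s z := by
      intro z hne hlt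
      refine lt_of_le_of_ne (H.height_nonneg s z) fun h0 => hne ?_
      have := hu θ₁ z h1 h0.symm
      rw [abs_lt] at hlt
      have := (Real.cos_eq_one_iff_of_lt_of_lt hlt.1 hlt.2).mp this
      linarith
    by_cases hm : θ₁ = (a + b) / 2
    · refine ⟨a, ⟨le_rfl, hab.le⟩, key a (by rw [hm]; linarith) ?_⟩
      rw [hm, abs_lt]
      constructor <;> linarith
    · refine ⟨(a + b) / 2, ⟨by linarith, by linarith⟩, key _ (Ne.symm hm) ?_⟩
      rw [abs_lt]
      constructor <;> linarith [hθ₁.1, hθ₁.2]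
  have hAc : IsCompact (Set.Icc a b ∩ {θ | Real.cos (θ - θ₁) ≤ 1 - ε}) :=
    isCompact_Icc.inter_right (isClosed_le (by fun_prop) continuous_const)
  -- Away from θ₁ modulo 2π the height is bounded below, so for small lam all directions of the
  -- sublevel set have cosine above 1 − ε.
  obtain ⟨lam₁, hlam₁, hle₁⟩ := exists_pos_le_of_isCompact hAc (H.continuous_height_right s) (by
    rintro θ ⟨_, hθ⟩
    refine lt_of_le_of_ne (H.height_nonneg s θ) fun h0 => ?_
    have := hu θ₁ θ h1 h0.symm
    have hθ' : Real.cos (θ - θ₁) ≤ 1 - ε := hθ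
    linarith)
  refine ⟨min lam₁ (height X h s z), lt_min hlam₁ hzpos, fun lam hlam hle => ?_⟩
  have hcos : ∀ θ ∈ Set.Icc a b ∩ {θ | height X h s θ < lam}, 1 - ε < Real.cos (θ - θ₁) := by
    rintro θ ⟨hθ, hlt⟩
    by_contra hcon
    have h2 := hle₁ θ ⟨hθ, not_lt.mp hcon⟩
    have hlt' : height X h s θ < lam := hlt
    linarith [hle.trans (min_le_left _ _)]
  have hEm : MeasurableSet (Set.Icc a b ∩ {θ | height X h s θ < lam}) :=
    measurableSet_Icc.inter (H.measurableSet_section s lam)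
  constructor
  · have h2 : ENNReal.ofReal lam ≤ ∫⁻ θ in Set.Icc a b ∩ {θ | height X h s θ < lam},
        ‖deriv (height X h s) θ‖ₑ := by
      -- θ₁ may be an endpoint of [a, b]; only the side containing z is sure to be available, whence
      -- lam and not 2·lam.
      rcases le_total θ₁ z with h | h
      · refine (le_lintegral_enorm_deriv_sublevel hK h h1 hlam
          (hle.trans (min_le_right _ _))).trans (lintegral_mono_set ?_)
        exact Set.inter_subset_inter_left _ (Set.Icc_subset_Icc hθ₁.1 hz.2)
      · refine (le_lintegral_enorm_deriv_sublevel_left hK h h1 hlam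
          (hle.trans (min_le_right _ _))).trans (lintegral_mono_set ?_)
        exact Set.inter_subset_inter_left _ (Set.Icc_subset_Icc hz.1 hθ₁.2)
    rw [posSweep, H.sweep_eq, ENNReal.ofReal_mul (by linarith)]
    refine (mul_le_mul_right h2 _).trans ?_
    rw [← lintegral_const_mul _ (measurable_deriv _).enorm]
    refine lintegral_mono_ae ?_
    filter_upwards [ae_restrict_of_ae (hs θ₁ h1), ae_restrict_mem hEm] with θ hθ hθE
    rw [← ofReal_norm, ← ENNReal.ofReal_mul (by linarith), Real.norm_eq_abs, hθ]
    refine ENNReal.ofReal_le_ofReal ?_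
    rw [mul_comm]
    exact mul_le_mul_of_nonneg_left (hcos θ hθE).le (abs_nonneg _)
  · rw [negSweep, H.sweep_eq]
    refine (setLIntegral_congr_fun_ae hEm ?_).trans (lintegral_zero)
    filter_upwards [hs θ₁ h1] with θ hθ hθE
    rw [hθ, ENNReal.ofReal_of_nonpos]
    have := hcos θ hθE
    have := mul_nonneg (abs_nonneg (deriv (height X h s) θ))
      (by linarith : 0 ≤ Real.cos (θ - θ₁))
    linarith

end IsSupportedCurve

/-! ### Exchange of integrals, and limits as ρ → ∞. -/

theorem ofReal_integral_le_lintegral_ofReal {α : Type*} [MeasurableSpace α] {ν : Measure α}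
    {f : α → ℝ} (hf : Integrable f ν) :
    ENNReal.ofReal (∫ x, f x ∂ν) ≤ ∫⁻ x, ENNReal.ofReal (f x) ∂ν := by
  rw [integral_eq_lintegral_pos_part_sub_lintegral_neg_part hf]
  exact (ENNReal.ofReal_le_ofReal (sub_le_self _ ENNReal.toReal_nonneg)).trans
    ENNReal.ofReal_toReal_le

theorem lintegral_ofReal_le_add {α : Type*} [MeasurableSpace α] {ν : Measure α}
    {f : α → ℝ} (hf : Integrable f ν) :
    ∫⁻ x, ENNReal.ofReal (f x) ∂ν
      ≤ ENNReal.ofReal (∫ x, f x ∂ν) + ∫⁻ x, ENNReal.ofReal (-f x) ∂ν := by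
  have h := integral_eq_lintegral_pos_part_sub_lintegral_neg_part hf
  have h1 : ∫⁻ x, ENNReal.ofReal (f x) ∂ν ≠ ⊤ := hf.lintegral_lt_top.ne
  have h2 : ∫⁻ x, ENNReal.ofReal (-f x) ∂ν ≠ ⊤ := hf.neg.lintegral_lt_top.ne
  rw [← ENNReal.ofReal_toReal h1, ← ENNReal.ofReal_toReal h2]
  refine le_trans (ENNReal.ofReal_le_ofReal ?_) ENNReal.ofReal_add_le
  linarith

/-- The area (divided by the height and signed) swept by the chords of height `lam` near the
direction `θ`. -/
def sweep (X : ℝ → Plane) (h : ℝ → ℝ) (L lam θ : ℝ) : ℝ :=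
  ∫ s in Set.Ico 0 L ∩ {s | height X h s θ < lam}, density X h s θ

namespace IsSupportedCurve

variable {X : ℝ → Plane} {h : ℝ → ℝ} {c : Plane} {δ M : ℝ}

/-- Membership in the low sets agrees pointwise with membership in the touching set for large ρ, and
[0, L) has finite measure. -/
theorem tendsto_measure_lowSet (H : IsSupportedCurve X h c δ M) (a b L : ℝ) :
    Tendsto (fun ρ : ℝ => volume.restrict (Set.Ico 0 L) (lowSet X h a b ρ⁻¹)) atTop
      (𝓝 (volume.restrict (Set.Ico 0 L) (touchSet X h a b))) := by
  refine tendsto_measure_of_tendsto_indicator_of_isFiniteMeasure atTop _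
    (fun ρ => (H.isOpen_lowSet a b _).measurableSet) fun s => ?_
  by_cases hs : s ∈ touchSet X h a b
  · filter_upwards [eventually_gt_atTop 0] with ρ hρ
    exact iff_of_true (touchSet_subset_lowSet (inv_pos.mpr hρ) hs) hs
  · obtain ⟨lam₀, h1, h2⟩ := H.exists_notMem_lowSet hs
    filter_upwards [eventually_inv_le h1] with ρ hρ
    exact iff_of_false (h2 _ hρ.2) hs

theorem lintegral_posSweep_le (H : IsSupportedCurve X h c δ M) {a b : ℝ}
    (hb : b ≤ a + 2 * Real.pi) (L : ℝ) {ρ : ℝ} (hρ : 0 < ρ) :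
    ENNReal.ofReal ρ * ∫⁻ s in Set.Ico 0 L, posSweep X h a b ρ⁻¹ s
      ≤ 2 * volume.restrict (Set.Ico 0 L) (lowSet X h a b ρ⁻¹) := by
  calc ENNReal.ofReal ρ * ∫⁻ s in Set.Ico 0 L, posSweep X h a b ρ⁻¹ s
      ≤ ENNReal.ofReal ρ * ∫⁻ s in Set.Ico 0 L,
          (lowSet X h a b ρ⁻¹).indicator (fun _ => 2 * ENNReal.ofReal ρ⁻¹) s := by
        refine mul_le_mul_right (lintegral_mono_ae (ae_restrict_of_ae ?_)) _
        filter_upwards [H.posSweep_le hb] with s hs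
        exact hs _
    _ = (ENNReal.ofReal ρ * ENNReal.ofReal ρ⁻¹) *
          (2 * volume.restrict (Set.Ico 0 L) (lowSet X h a b ρ⁻¹)) := by
        rw [lintegral_indicator_const (H.isOpen_lowSet a b _).measurableSet]
        ring
    _ = _ := by
        rw [← ENNReal.ofReal_mul hρ.le, mul_inv_cancel₀ hρ.ne', ENNReal.ofReal_one, one_mul]

/-- ρ·`posSweep` is only known to lie asymptotically between 1 and 2 on the touching set. Truncation
at 1 makes it converge to the indicator, with 1 as dominating function. -/
theorem tendsto_lintegral_min_posSweep (H : IsSupportedCurve X h c δ M) {a b : ℝ} (hab : a < b)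
    (hb : b ≤ a + 2 * Real.pi) (L : ℝ) :
    Tendsto (fun ρ : ℝ => ∫⁻ s in Set.Ico 0 L, min (ENNReal.ofReal ρ * posSweep X h a b ρ⁻¹ s) 1)
      atTop (𝓝 (volume.restrict (Set.Ico 0 L) (touchSet X h a b))) := by
  rw [← lintegral_indicator_one (H.measurableSet_touchSet a b)]
  refine tendsto_lintegral_filter_of_dominated_convergence (fun _ => 1)
    (Eventually.of_forall fun ρ => ((H.measurable_posSweep a b _).const_mul _).min
      measurable_const)
    (Eventually.of_forall fun ρ => Eventually.of_forall fun s => min_le_right _ _)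
    (by simp) (ae_restrict_of_ae ?_)
  filter_upwards [H.eventually_le_posSweep hab hb] with s hs
  by_cases hts : s ∈ touchSet X h a b
  · rw [Set.indicator_of_mem hts, Pi.one_apply]
    refine tendsto_order.mpr ⟨fun x hx => ?_, fun x hx =>
      Eventually.of_forall fun ρ => (min_le_right _ _).trans_lt hx⟩
    obtain ⟨y, hxy, hy1⟩ := exists_between hx
    lift y to ℝ≥0 using (hy1.trans ENNReal.one_lt_top).ne
    have hy1' : (y : ℝ) < 1 := by exact_mod_cast hy1
    have hy0 : (0 : ℝ) < y := by
      have : 0 < y := by exact_mod_cast (zero_le.trans_lt hxy)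
      exact_mod_cast this
    obtain ⟨lam₀, h1, h2⟩ := hs hts (1 - y) (by linarith) (by linarith)
    filter_upwards [eventually_inv_le h1] with ρ hρ
    refine lt_min ?_ hx
    refine hxy.trans_le ?_
    have h3 := (h2 ρ⁻¹ (inv_pos.mpr hρ.1) hρ.2).1
    refine le_trans ?_ (mul_le_mul_right h3 _)
    rw [← ENNReal.ofReal_mul hρ.1.le, sub_sub_cancel, mul_comm, mul_assoc,
      inv_mul_cancel₀ hρ.1.ne', mul_one, ENNReal.ofReal_coe_nnreal]
  · rw [Set.indicator_of_notMem hts]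
    obtain ⟨lam₀, h1, h2⟩ := H.exists_notMem_lowSet hts
    refine tendsto_const_nhds.congr' ?_
    filter_upwards [eventually_inv_le h1] with ρ hρ
    rw [posSweep, H.sweep_eq_zero _ (h2 _ hρ.2)]
    simp

/-- For almost every s the integrand is zero once ρ is large, and `negSweep_le` supplies a constant
majorant. -/
theorem tendsto_lintegral_negSweep (H : IsSupportedCurve X h c δ M) {a b : ℝ} (hab : a < b)
    (hb : b ≤ a + 2 * Real.pi) (L : ℝ) :
    Tendsto (fun ρ : ℝ => ENNReal.ofReal ρ * ∫⁻ s in Set.Ico 0 L, negSweep X h a b ρ⁻¹ s)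
      atTop (𝓝 0) := by
  have hδ := H.pos
  have hM := H.bound_nonneg
  have hpi := Real.pi_pos
  simp_rw [← lintegral_const_mul _ (H.measurable_negSweep a b _)]
  rw [show (0 : ℝ≥0∞) = ∫⁻ s in Set.Ico 0 L, (0 : ℝ≥0∞) by simp]
  refine tendsto_lintegral_filter_of_dominated_convergence
    (fun _ => 2 * ENNReal.ofReal (2 * M / δ * (1 + Real.pi)))
    (Eventually.of_forall fun ρ => (H.measurable_negSweep a b _).const_mul _) ?_ ?_
    (ae_restrict_of_ae ?_)
  · filter_upwards [eventually_inv_le (half_pos hδ)] with ρ hρ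
    refine ae_restrict_of_ae ?_
    filter_upwards [H.negSweep_le hb] with s hs
    refine (mul_le_mul_right (hs _ hρ.2) _).trans (le_of_eq ?_)
    rw [mul_left_comm, ← ENNReal.ofReal_mul hρ.1.le]
    congr 2
    have := hρ.1.ne'
    field_simp
  · simp [ENNReal.mul_eq_top]
  · filter_upwards [H.eventually_le_posSweep hab hb] with s hs
    refine tendsto_const_nhds.congr' ?_
    by_cases hts : s ∈ touchSet X h a b
    · obtain ⟨lam₀, h1, h2⟩ := hs hts (1 / 2) (by norm_num) (by norm_num)
      filter_upwards [eventually_inv_le h1] with ρ hρ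
      rw [(h2 ρ⁻¹ (inv_pos.mpr hρ.1) hρ.2).2, mul_zero]
    · obtain ⟨lam₀, h1, h2⟩ := H.exists_notMem_lowSet hts
      filter_upwards [eventually_inv_le h1] with ρ hρ
      rw [negSweep, H.sweep_eq_zero _ (h2 _ hρ.2), mul_zero]

theorem measurableSet_cap (H : IsSupportedCurve X h c δ M) (θ lam : ℝ) :
    MeasurableSet {s | height X h s θ < lam} :=
  (isOpen_lt (H.continuous_height.comp (by fun_prop : Continuous fun s : ℝ => (s, θ)))
    continuous_const).measurableSet

theorem integrableOn_density (H : IsSupportedCurve X h c δ M) (L lam θ : ℝ) :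
    IntegrableOn (fun s => density X h s θ)
      (Set.Ico 0 L ∩ {s | height X h s θ < lam}) := by
  refine IntegrableOn.mono_set (t := Set.Ico 0 L) ?_ Set.inter_subset_left
  have hm : Measurable fun s => density X h s θ :=
    H.measurable_density.comp (by fun_prop : Measurable fun s : ℝ => (s, θ))
  refine Measure.integrableOn_of_bounded (M := M + ‖c‖ + |deriv h θ|) (by simp)
    hm.aestronglyMeasurable (Eventually.of_forall fun s => ?_)
  rw [density, norm_mul, Real.norm_eq_abs, Real.norm_eq_abs, abs_abs, abs_neg]
  have h1 : |tangential (deriv X s) θ| ≤ 1 :=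
    (abs_tangential_le _ _).trans (by simpa using norm_deriv_le_of_lipschitz H.lipschitz (x₀ := s))
  have h2 : |tangential (X s) θ - deriv h θ| ≤ M + ‖c‖ + |deriv h θ| := by
    refine (abs_sub _ _).trans (add_le_add_left ?_ _)
    refine (abs_tangential_le _ _).trans ?_
    have := norm_add_le (X s - c) c
    rw [sub_add_cancel] at this
    linarith [H.bounded s]
  calc _ ≤ (M + ‖c‖ + |deriv h θ|) * 1 := mul_le_mul h2 h1 (abs_nonneg _) (by positivity [H.bound_nonneg])
    _ = _ := mul_one _

theorem lintegral_cap_eq (H : IsSupportedCurve X h c δ M) (L lam θ : ℝ) (g : ℝ × ℝ → ℝ≥0∞) :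
    ∫⁻ s in Set.Ico 0 L ∩ {s | height X h s θ < lam}, g (s, θ)
      = ∫⁻ s in Set.Ico 0 L, {p : ℝ × ℝ | height X h p.1 p.2 < lam}.indicator g (s, θ) := by
  rw [Set.inter_comm, ← setLIntegral_indicator (H.measurableSet_cap θ lam)]
  rfl

theorem lintegral_cap_swap (H : IsSupportedCurve X h c δ M) (a b L lam : ℝ)
    {g : ℝ × ℝ → ℝ≥0∞} (hg : Measurable g) :
    ∫⁻ θ in Set.Icc a b, ∫⁻ s in Set.Ico 0 L ∩ {s | height X h s θ < lam}, g (s, θ)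
      = ∫⁻ s in Set.Ico 0 L, ∫⁻ θ in Set.Icc a b,
          {p : ℝ × ℝ | height X h p.1 p.2 < lam}.indicator g (s, θ) := by
  simp_rw [H.lintegral_cap_eq]
  exact lintegral_lintegral_swap
    (f := fun θ s => {p : ℝ × ℝ | height X h p.1 p.2 < lam}.indicator g (s, θ))
    ((hg.indicator (H.measurableSet_height_lt lam)).comp measurable_swap).aemeasurable

theorem lintegral_sweep_le (H : IsSupportedCurve X h c δ M) (a b L lam : ℝ) :
    ∫⁻ θ in Set.Icc a b, ENNReal.ofReal (sweep X h L lam θ)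
      ≤ ∫⁻ s in Set.Ico 0 L, posSweep X h a b lam s := by
  simp_rw [posSweep]
  rw [← H.lintegral_cap_swap a b L lam H.measurable_density.ennreal_ofReal]
  exact lintegral_mono fun θ =>
    ofReal_integral_le_lintegral_ofReal (H.integrableOn_density L lam θ)

/-- `sweep` is a signed integral, so recovering its positive part costs exactly the negative one,
which is negligible in the limit. -/
theorem lintegral_posSweep_le_add (H : IsSupportedCurve X h c δ M) (a b L lam : ℝ) :
    ∫⁻ s in Set.Ico 0 L, posSweep X h a b lam s
      ≤ (∫⁻ θ in Set.Icc a b, ENNReal.ofReal (sweep X h L lam θ))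
        + ∫⁻ s in Set.Ico 0 L, negSweep X h a b lam s := by
  have hneg : Measurable fun p : ℝ × ℝ => ENNReal.ofReal (-density X h p.1 p.2) :=
    H.measurable_density.neg.ennreal_ofReal
  simp_rw [posSweep, negSweep]
  rw [← H.lintegral_cap_swap a b L lam H.measurable_density.ennreal_ofReal,
    ← H.lintegral_cap_swap a b L lam hneg, ← lintegral_add_right]
  · exact lintegral_mono fun θ => lintegral_ofReal_le_add (H.integrableOn_density L lam θ)
  · simp_rw [H.lintegral_cap_eq L lam _ fun p => ENNReal.ofReal (-density X h p.1 p.2)]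
    exact (H.measurable_negIntegrand lam).lintegral_prod_left'

theorem measurable_sweep (H : IsSupportedCurve X h c δ M) (L lam : ℝ) :
    Measurable (sweep X h L lam) := by
  have h1 : sweep X h L lam = fun θ => ∫ s in Set.Ico 0 L,
      {p : ℝ × ℝ | height X h p.1 p.2 < lam}.indicator (fun p => density X h p.1 p.2) (s, θ) := by
    ext θ
    rw [sweep, ← setIntegral_indicator (H.measurableSet_cap θ lam)]
    rfl
  rw [h1]
  exact ((H.measurable_density.indicator
    (H.measurableSet_height_lt lam)).stronglyMeasurable.integral_prod_left').measurable

end IsSupportedCurve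

/-! ### From unit speed in the sense of variation to a unit derivative. -/

section UnitSpeed

variable {X : ℝ → Plane}

theorem intervalIntegrable_norm_deriv {K : ℝ≥0} (hX : LipschitzWith K X) (p q : ℝ) :
    IntervalIntegrable (fun t => ‖deriv X t‖) volume p q := by
  have hc : IntervalIntegrable (fun _ : ℝ => (K : ℝ)) volume p q := intervalIntegrable_const
  refine hc.mono_fun (measurable_deriv X).norm.aestronglyMeasurable
    (Eventually.of_forall fun t => ?_)
  simpa using norm_deriv_le_of_lipschitz hX (x₀ := t)

/-- The fundamental theorem of calculus for the scalar function ⟨v, X⟩, with v the displacement,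
followed by Cauchy–Schwarz. -/
theorem norm_sub_le_integral_norm_deriv {K : ℝ≥0} (hX : LipschitzWith K X) {p q : ℝ}
    (hpq : p ≤ q) : ‖X q - X p‖ ≤ ∫ t in p..q, ‖deriv X t‖ := by
  set v := X q - X p with hv
  rcases eq_or_ne v 0 with h0 | h0
  · rw [h0, norm_zero]
    exact intervalIntegral.integral_nonneg hpq fun t _ => norm_nonneg _
  have hL : LipschitzWith (‖innerSL ℝ v‖₊ * K) (fun t => innerSL ℝ v (X t)) :=
    (innerSL ℝ v).lipschitz.comp hX
  have hac := (hL.lipschitzOnWith (s := Set.uIcc p q)).absolutelyContinuousOnInterval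
  have h1 := hac.integral_deriv_eq_sub
  have h2 : innerSL ℝ v (X q) - innerSL ℝ v (X p) = ‖v‖ * ‖v‖ := by
    rw [← map_sub, ← hv, innerSL_apply_apply, real_inner_self_eq_norm_mul_norm]
  have h3 : ∫ t in p..q, deriv (fun t => innerSL ℝ v (X t)) t
      ≤ ∫ t in p..q, ‖v‖ * ‖deriv X t‖ := by
    refine intervalIntegral.integral_mono_ae hpq hac.intervalIntegrable_deriv
      ((intervalIntegrable_norm_deriv hX p q).const_mul _) ?_
    filter_upwards [hX.ae_differentiableAt_real] with t ht
    have h4 : HasDerivAt (fun t => innerSL ℝ v (X t)) (innerSL ℝ v (deriv X t)) t :=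
      (innerSL ℝ v).hasFDerivAt.comp_hasDerivAt t ht.hasDerivAt
    rw [h4.deriv, innerSL_apply_apply]
    exact real_inner_le_norm _ _
  rw [h1, h2, intervalIntegral.integral_const_mul] at h3
  exact le_of_mul_le_mul_left h3 (norm_pos_iff.mpr h0)

theorem eVariationOn_le_of_edist_le {f : ℝ → Plane} {g : ℝ → ℝ} {s : Set ℝ}
    (h : ∀ x ∈ s, ∀ y ∈ s, edist (f x) (f y) ≤ edist (g x) (g y)) :
    eVariationOn f s ≤ eVariationOn g s := by
  refine iSup_mono fun p => Finset.sum_le_sum fun i _ => ?_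
  exact h _ (p.2.2.2 _) _ (p.2.2.2 _)

/-- A curve of unit speed in the sense of variations has a unit derivative almost everywhere. -/
theorem ae_norm_deriv_eq_one (hX : LipschitzWith 1 X) (hu : HasUnitSpeedOn X Set.univ) :
    ∀ᵐ s, ‖deriv X s‖ = 1 := by
  have key : ∀ n : ℕ, ∀ᵐ s, s ∈ Set.Ioc (-(n : ℝ)) n → ‖deriv X s‖ = 1 := by
    intro n
    have hn : -(n : ℝ) ≤ n := by linarith [(Nat.cast_nonneg n : (0 : ℝ) ≤ n)]
    set g : ℝ → ℝ := fun t => ∫ r in (-(n : ℝ))..t, ‖deriv X r‖ with hg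
    have hii := intervalIntegrable_norm_deriv hX
    have hsub : ∀ x y, g y - g x = ∫ r in x..y, ‖deriv X r‖ := fun x y =>
      intervalIntegral.integral_interval_sub_left (hii _ _) (hii _ _)
    have hmono : Monotone g := by
      intro x y hxy
      have h1 := hsub x y
      have h2 : 0 ≤ ∫ r in x..y, ‖deriv X r‖ :=
        intervalIntegral.integral_nonneg hxy fun t _ => norm_nonneg _
      linarith
    have hvar : eVariationOn X (Set.Icc (-(n : ℝ)) n) ≤ ENNReal.ofReal (g n - g (-n)) := by
      have hg1 := ((hmono.monotoneOn (Set.Icc (-(n : ℝ)) n)).eVariationOn_eq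
        (Set.left_mem_Icc.mpr hn) (Set.right_mem_Icc.mpr hn)).le
      rw [Set.inter_self] at hg1
      refine (eVariationOn_le_of_edist_le (g := g) ?_).trans hg1
      have hle : ∀ x y, x ≤ y → edist (X x) (X y) ≤ edist (g x) (g y) := by
        intro x y hxy
        rw [edist_dist, edist_dist]
        refine ENNReal.ofReal_le_ofReal ?_
        rw [dist_comm, dist_eq_norm, dist_comm, Real.dist_eq, hsub]
        exact (norm_sub_le_integral_norm_deriv hX hxy).trans (le_abs_self _)
      intro x _ y _
      rcases le_total x y with h | h
      · exact hle x y h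
      · rw [edist_comm, edist_comm (g x)]
        exact hle y x h
    have h1 := hu (Set.mem_univ (-(n : ℝ))) (Set.mem_univ (n : ℝ))
    rw [Set.univ_inter] at h1
    rw [h1, hsub, ENNReal.ofReal_le_ofReal_iff
      (intervalIntegral.integral_nonneg hn fun t _ => norm_nonneg _)] at hvar
    have hle1 : ∀ t, ‖deriv X t‖ ≤ 1 := fun t => by
      simpa using norm_deriv_le_of_lipschitz hX (x₀ := t)
    -- The variation 2n is at most ∫‖X'‖; since ‖X'‖ ≤ 1, the nonnegative integrand must vanish
    -- almost everywhere.
    have h2 : ∫ t in (-(n : ℝ))..n, (1 - ‖deriv X t‖) ≤ 0 := by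
      rw [intervalIntegral.integral_sub intervalIntegrable_const (hii _ _),
        intervalIntegral.integral_const]
      simp only [NNReal.coe_one, one_mul] at hvar
      simp only [smul_eq_mul, mul_one]
      linarith
    have h3 : ∫ t in (-(n : ℝ))..n, (1 - ‖deriv X t‖) = 0 :=
      le_antisymm h2 (intervalIntegral.integral_nonneg hn fun t _ => sub_nonneg.mpr (hle1 t))
    rw [intervalIntegral.integral_eq_zero_iff_of_le_of_nonneg_ae hn
      (Eventually.of_forall fun t => sub_nonneg.mpr (hle1 t))
      (intervalIntegrable_const.sub (hii _ _))] at h3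
    rw [Filter.EventuallyEq, ae_restrict_iff' measurableSet_Ioc] at h3
    filter_upwards [h3] with t ht hmem
    have := ht hmem
    simp only [Pi.zero_apply] at this
    linarith
  rw [← ae_all_iff] at key
  filter_upwards [key] with s hs
  obtain ⟨n, hn⟩ := exists_nat_gt |s|
  rw [abs_lt] at hn
  exact hs n ⟨hn.1, hn.2.le⟩

end UnitSpeed

/-! ### Arc length of a periodic Lipschitz curve. -/

section Parameterization

variable {γ : ℝ → Plane} {K : ℝ≥0}

/-- The signed length of the curve `γ` from the parameter `0`. -/
def arcLength (γ : ℝ → Plane) : ℝ → ℝ := variationOnFromTo γ Set.univ 0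

theorem arcLength_zero : arcLength γ 0 = 0 := variationOnFromTo.self _ _ _

theorem arcLength_sub (hγ : LipschitzWith K γ) {s t : ℝ} (hst : s ≤ t) :
    arcLength γ t - arcLength γ s = (eVariationOn γ (Set.Icc s t)).toReal := by
  rw [arcLength, variationOnFromTo.sub_right (hγ.locallyBoundedVariationOn _) (Set.mem_univ _)
    (Set.mem_univ _) (Set.mem_univ _), variationOnFromTo.eq_of_le _ _ hst, Set.univ_inter]

theorem eVariationOn_Icc_le (hγ : LipschitzWith K γ) (s t : ℝ) :
    eVariationOn γ (Set.Icc s t) ≤ K * ENNReal.ofReal (t - s) := by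
  have h := (hγ.lipschitzOnWith (s := Set.univ)).comp_eVariationOn_le (g := id)
    (s := Set.Icc s t) (Set.mapsTo_univ _ _)
  rwa [Function.comp_id, eVariationOn_id_Icc] at h

theorem monotone_arcLength (hγ : LipschitzWith K γ) : Monotone (arcLength γ) := fun s t hst => by
  have := arcLength_sub hγ hst
  have : 0 ≤ (eVariationOn γ (Set.Icc s t)).toReal := ENNReal.toReal_nonneg
  linarith

theorem continuous_arcLength (hγ : LipschitzWith K γ) : Continuous (arcLength γ) := by
  refine (LipschitzWith.of_le_add_mul K fun s t => ?_).continuous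
  rcases le_total s t with h | h
  · have := monotone_arcLength hγ h
    have : 0 ≤ K * dist s t := by positivity
    linarith
  · have h1 := arcLength_sub hγ h
    have h2 := ENNReal.toReal_mono (by finiteness) (eVariationOn_Icc_le hγ t s)
    rw [ENNReal.toReal_mul, ENNReal.toReal_ofReal (by linarith), ENNReal.coe_toReal] at h2
    rw [Real.dist_eq, abs_of_nonneg (by linarith)]
    linarith

theorem naturalParameterization_arcLength (hγ : LipschitzWith K γ) (t : ℝ) :
    naturalParameterization γ Set.univ 0 (arcLength γ t) = γ t :=
  edist_eq_zero.mp (edist_naturalParameterization_eq_zero (hγ.locallyBoundedVariationOn _)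
    (Set.mem_univ _) (Set.mem_univ _))

theorem arcLength_add_period (hγ : LipschitzWith K γ) {T : ℝ} (hT : 0 ≤ T)
    (hp : ∀ t, γ (t + T) = γ t) (t : ℝ) :
    arcLength γ (t + T) = arcLength γ t + (eVariationOn γ (Set.Icc 0 T)).toReal := by
  have h1 := variationOnFromTo.comp_eq_of_monotoneOn γ (t := Set.univ) (fun r => r + T)
    (fun x _ y _ hxy => by simpa using hxy) (Set.mem_univ 0) (Set.mem_univ t)
  have h2 : γ ∘ (fun r => r + T) = γ := funext hp
  have h3 : (fun r : ℝ => r + T) '' Set.univ = Set.univ := by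
    rw [Set.image_univ]
    exact (Equiv.addRight T).surjective.range_eq
  rw [h2, h3, zero_add] at h1
  have h4 := arcLength_sub hγ hT
  rw [arcLength_zero, sub_zero] at h4
  have h5 := variationOnFromTo.add (hγ.locallyBoundedVariationOn _) (Set.mem_univ (0 : ℝ))
    (Set.mem_univ T) (Set.mem_univ (t + T))
  rw [← h4, arcLength, ← h5, ← h1, add_comm]

theorem length_pos (hγ : LipschitzWith K γ) {T r : ℝ} (hr : r ∈ Set.Icc 0 T)
    (hne : γ 0 ≠ γ r) : 0 < (eVariationOn γ (Set.Icc 0 T)).toReal := by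
  refine ENNReal.toReal_pos ?_ ((eVariationOn_Icc_le hγ 0 T).trans_lt (by finiteness)).ne
  refine (lt_of_lt_of_le (edist_pos.mpr hne)
    (eVariationOn.edist_le γ (Set.left_mem_Icc.mpr (hr.1.trans hr.2)) hr)).ne'

/-- Each period adds the same positive length, so arc length is unbounded in both directions.
Surjectivity lets every property of the natural parameterization be checked on γ itself. -/
theorem surjective_arcLength (hγ : LipschitzWith K γ) {T r : ℝ} (hr : r ∈ Set.Icc 0 T)
    (hne : γ 0 ≠ γ r) (hp : ∀ t, γ (t + T) = γ t) : Function.Surjective (arcLength γ) := by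
  have hL := length_pos hγ hr hne
  set L := (eVariationOn γ (Set.Icc 0 T)).toReal
  have hT : 0 ≤ T := hr.1.trans hr.2
  have hnat : ∀ n : ℕ, arcLength γ (n * T) = n * L := by
    intro n
    induction n with
    | zero => simp [arcLength_zero]
    | succ k ih =>
      push_cast
      rw [add_mul, one_mul, arcLength_add_period hγ hT hp, ih]
      ring
  have hneg : ∀ n : ℕ, arcLength γ (-(n * T)) = -(n * L) := by
    intro n
    induction n with
    | zero => simp [arcLength_zero]
    | succ k ih =>
      have := arcLength_add_period hγ hT hp (-((k + 1) * T))
      rw [show -(((k : ℝ) + 1) * T) + T = -(k * T) by ring, ih] at this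
      push_cast
      linarith
  intro y
  obtain ⟨n, hn⟩ := exists_nat_gt (|y| / L)
  rw [div_lt_iff₀ hL, abs_lt] at hn
  exact mem_range_of_exists_le_of_exists_ge (continuous_arcLength hγ)
    ⟨-(n * T), by rw [hneg]; exact hn.1.le⟩ ⟨n * T, by rw [hnat]; exact hn.2.le⟩

theorem hasUnitSpeedOn_naturalParameterization (hγ : LipschitzWith K γ)
    (hs : Function.Surjective (arcLength γ)) :
    HasUnitSpeedOn (naturalParameterization γ Set.univ 0) Set.univ := by
  have := has_unit_speed_naturalParameterization γ (hγ.locallyBoundedVariationOn Set.univ)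
    (Set.mem_univ (0 : ℝ))
  have hr : Set.range (variationOnFromTo γ Set.univ 0) = Set.univ := hs.range_eq
  rwa [Set.image_univ, hr] at this

theorem lipschitzWith_of_hasUnitSpeedOn {X : ℝ → Plane} (hX : HasUnitSpeedOn X Set.univ) :
    LipschitzWith 1 X := by
  have key : ∀ s t, s ≤ t → edist (X s) (X t) ≤ edist s t := by
    intro s t hst
    have h1 := hX (Set.mem_univ s) (Set.mem_univ t)
    rw [Set.univ_inter] at h1
    refine (eVariationOn.edist_le X (Set.left_mem_Icc.mpr hst)
      (Set.right_mem_Icc.mpr hst)).trans ?_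
    rw [h1, edist_dist, dist_comm, Real.dist_eq]
    refine ENNReal.ofReal_le_ofReal ?_
    simpa using le_abs_self (t - s)
  intro s t
  rw [ENNReal.coe_one, one_mul]
  rcases le_total s t with h | h
  · exact key s t h
  · rw [edist_comm, edist_comm s]
    exact key t s h

end Parameterization

/-! ### Unit vectors, and the support function of a convex body. -/

theorem u_coe (θ : ℝ) : u (θ : Real.Angle) = !₂[Real.cos θ, Real.sin θ] := by
  rw [u, Real.Angle.cos_coe, Real.Angle.sin_coe]

theorem inner_u (x : Plane) (θ : ℝ) : inner ℝ x (u (θ : Real.Angle)) = radial x θ := by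
  rw [u_coe, PiLp.inner_apply]
  simp [radial, mul_comm]

theorem norm_u (θ : ℝ) : ‖u (θ : Real.Angle)‖ = 1 := by
  rw [u_coe, ← pow_left_inj₀ (norm_nonneg _) zero_le_one two_ne_zero, norm_sq_plane]
  simp

theorem norm_u_sub_le (s t : ℝ) :
    ‖u (s : Real.Angle) - u (t : Real.Angle)‖ ≤ 2 * |s - t| := by
  rw [u_coe, u_coe]
  refine abs_le_of_sq_le_sq' ?_ (by positivity) |>.2
  rw [norm_sq_plane]
  have h1 := Real.abs_cos_sub_cos_le s t
  have h2 := Real.abs_sin_sub_sin_le s t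
  have h3 := sq_le_sq' (by linarith [neg_abs_le (Real.cos s - Real.cos t), abs_nonneg (s - t)])
    ((le_abs_self _).trans h1)
  have h4 := sq_le_sq' (by linarith [neg_abs_le (Real.sin s - Real.sin t), abs_nonneg (s - t)])
    ((le_abs_self _).trans h2)
  simp
  nlinarith [sq_abs (s - t)]

theorem radial_u (t θ : ℝ) : radial (u (t : Real.Angle)) θ = Real.cos (t - θ) := by
  rw [u_coe, Real.cos_sub]; simp [radial]

theorem radial_smul (r : ℝ) (x : Plane) (θ : ℝ) : radial (r • x) θ = r * radial x θ := by
  simp only [radial, PiLp.smul_apply, smul_eq_mul]; ring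

theorem radial_add (x y : Plane) (θ : ℝ) : radial (x + y) θ = radial x θ + radial y θ := by
  simp only [radial, PiLp.add_apply]; ring

theorem tangential_smul (r : ℝ) (x : Plane) (θ : ℝ) :
    tangential (r • x) θ = r * tangential x θ := by
  simp only [tangential, PiLp.smul_apply, smul_eq_mul]; ring

theorem tangential_add (x y : Plane) (θ : ℝ) :
    tangential (x + y) θ = tangential x θ + tangential y θ := by
  simp only [tangential, PiLp.add_apply]; ring

theorem exists_eq_norm_smul_u (v : Plane) : ∃ θ : ℝ, v = ‖v‖ • u (θ : Real.Angle) := by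
  have hn : ‖(⟨v 0, v 1⟩ : ℂ)‖ = ‖v‖ := by
    rw [← pow_left_inj₀ (norm_nonneg _) (norm_nonneg _) two_ne_zero, norm_sq_plane,
      Complex.sq_norm, Complex.normSq_apply]
    ring
  refine ⟨Complex.arg ⟨v 0, v 1⟩, ?_⟩
  have h1 := Complex.norm_mul_cos_arg ⟨v 0, v 1⟩
  have h2 := Complex.norm_mul_sin_arg ⟨v 0, v 1⟩
  rw [hn] at h1 h2
  rw [u_coe]
  ext i
  fin_cases i
  · simp [h1]
  · simp [h2]

/-- The support function of `C` as a function of a real angle. -/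
def support (C : Set Plane) (θ : ℝ) : ℝ := supportInf C (θ : Real.Angle)

/-- The Minkowski functional of `C` seen from its center. -/
def bodyGauge (C : Set Plane) : Plane → ℝ := gauge ((fun x => x - center C) '' C)

/-- `C` contains the closed `δ`-ball around its center and is contained in the closed `M`-ball. -/
structure HasRadii (C : Set Plane) (δ M : ℝ) : Prop where
  convex : Convex ℝ C
  pos : 0 < δ
  pos' : 0 < M
  closedBall_subset : Metric.closedBall (center C) δ ⊆ C
  norm_le : ∀ y ∈ C, ‖y - center C‖ ≤ M

theorem IsConvexBody.exists_hasRadii {C : Set Plane} (hC : IsConvexBody C) :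
    ∃ δ M, HasRadii C δ M := by
  have hc : center C ∈ interior C := Classical.epsilon_spec hC.nonempty_interior
  obtain ⟨δ, hδ, hball⟩ := Metric.nhds_basis_closedBall.mem_iff.mp (mem_interior_iff_mem_nhds.mp hc)
  obtain ⟨M, hM⟩ := hC.isBounded.subset_closedBall (center C)
  refine ⟨δ, max M 1, hC.convex, hδ, lt_max_of_lt_right one_pos, hball, fun y hy => ?_⟩
  rw [← dist_eq_norm]
  exact (Metric.mem_closedBall.mp (hM hy)).trans (le_max_left _ _)

namespace HasRadii

variable {C : Set Plane} {δ M : ℝ}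

theorem center_mem (hC : HasRadii C δ M) : center C ∈ C :=
  hC.closedBall_subset (Metric.mem_closedBall_self hC.pos.le)

theorem nonempty_interior (hC : HasRadii C δ M) : (interior C).Nonempty :=
  ⟨center C, mem_interior_iff_mem_nhds.mpr
    (Filter.mem_of_superset (Metric.closedBall_mem_nhds _ hC.pos) hC.closedBall_subset)⟩

theorem bddBelow_radial (hC : HasRadii C δ M) (θ : ℝ) :
    BddBelow (Set.range fun y : C => inner ℝ (y : Plane) (u (θ : Real.Angle))) := by
  refine ⟨radial (center C) θ - M, ?_⟩
  rintro _ ⟨y, rfl⟩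
  simp only [inner_u]
  have h1 := abs_radial_le (y - center C) θ
  rw [radial_sub] at h1
  have h2 := neg_abs_le (radial (y : Plane) θ - radial (center C) θ)
  linarith [hC.norm_le y y.2]

theorem support_le (hC : HasRadii C δ M) {y : Plane} (hy : y ∈ C) (θ : ℝ) :
    support C θ ≤ radial y θ := by
  rw [← inner_u]
  exact ciInf_le (hC.bddBelow_radial θ) (⟨y, hy⟩ : C)

theorem le_support (hC : HasRadii C δ M) {r θ : ℝ} (h : ∀ y ∈ C, r ≤ radial y θ) :
    r ≤ support C θ := by
  have : Nonempty C := ⟨⟨_, hC.center_mem⟩⟩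
  refine le_ciInf fun y => ?_
  rw [inner_u]
  exact h y y.2

theorem continuous_radial (θ : ℝ) : Continuous fun x : Plane => radial x θ := by
  unfold radial
  fun_prop

theorem support_le_of_mem_closure (hC : HasRadii C δ M) {y : Plane} (hy : y ∈ closure C) (θ : ℝ) :
    support C θ ≤ radial y θ :=
  closure_minimal (t := {y | support C θ ≤ radial y θ}) (fun _ hx => hC.support_le hx θ)
    (isClosed_le continuous_const (continuous_radial θ)) hy

theorem support_add_two_pi (C : Set Plane) (θ : ℝ) :
    support C (θ + 2 * Real.pi) = support C θ := by
  rw [support, support, Real.Angle.coe_add, Real.Angle.coe_two_pi, add_zero]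

theorem support_deep (hC : HasRadii C δ M) (θ : ℝ) :
    support C θ + δ ≤ radial (center C) θ := by
  have h1 : center C + (-δ) • u (θ : Real.Angle) ∈ C := by
    refine hC.closedBall_subset ?_
    rw [Metric.mem_closedBall, dist_eq_norm, add_sub_cancel_left, norm_smul, norm_u, mul_one,
      norm_neg, Real.norm_of_nonneg hC.pos.le]
  have h2 := hC.support_le h1 θ
  rw [radial_add, radial_smul, radial_u, sub_self, Real.cos_zero] at h2
  linarith

theorem lipschitz_support (hC : HasRadii C δ M) : ∃ K, LipschitzWith K (support C) := by
  have hK : 0 ≤ M + ‖center C‖ := add_nonneg hC.pos'.le (norm_nonneg _)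
  refine ⟨(M + ‖center C‖).toNNReal,
    LipschitzWith.of_le_add_mul _ fun θ θ' => ?_⟩
  suffices support C θ - (M + ‖center C‖) * dist θ θ' ≤ support C θ' by
    rw [Real.coe_toNNReal _ hK]; linarith
  refine hC.le_support fun y hy => ?_
  have h1 := hC.support_le hy θ
  have h2 := (lipschitzWith_radial y).dist_le_mul θ θ'
  rw [Real.dist_eq, coe_nnnorm] at h2
  have h3 := le_abs_self (radial y θ - radial y θ')
  have h4 : ‖y‖ ≤ M + ‖center C‖ := by
    have := norm_add_le (y - center C) (center C)
    rw [sub_add_cancel] at this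
    linarith [hC.norm_le y hy]
  have h5 := mul_le_mul_of_nonneg_right h4 (dist_nonneg (x := θ) (y := θ'))
  linarith

/-- For a single point p equality holds, by `radial_mul_sin`; the sines are nonnegative, so the
inequality passes to the infimum. -/
theorem support_concave (hC : HasRadii C δ M) (x y z : ℝ) (hxy : x ≤ y) (hyz : y ≤ z)
    (hzx : z ≤ x + Real.pi) :
    support C x * Real.sin (z - y) + support C z * Real.sin (y - x)
      ≤ support C y * Real.sin (z - x) := by
  have h1 : 0 ≤ Real.sin (z - y) :=
    Real.sin_nonneg_of_nonneg_of_le_pi (by linarith) (by linarith)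
  have h2 : 0 ≤ Real.sin (y - x) :=
    Real.sin_nonneg_of_nonneg_of_le_pi (by linarith) (by linarith)
  have h3 : 0 ≤ Real.sin (z - x) :=
    Real.sin_nonneg_of_nonneg_of_le_pi (by linarith) (by linarith)
  have key : ∀ p ∈ C, support C x * Real.sin (z - y) + support C z * Real.sin (y - x)
      ≤ radial p y * Real.sin (z - x) := by
    intro p hp
    rw [radial_mul_sin]
    exact add_le_add (mul_le_mul_of_nonneg_right (hC.support_le hp x) h1)
      (mul_le_mul_of_nonneg_right (hC.support_le hp z) h2)
  -- If sin(z − x) = 0 one cannot divide by it, but then the right side is zero whatever the point,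
  -- and the center serves.
  rcases h3.eq_or_lt with h | h
  · have := key _ hC.center_mem
    rw [← h] at this ⊢
    linarith
  · rw [← div_le_iff₀ h]
    refine hC.le_support fun p hp => ?_
    rw [div_le_iff₀ h]
    exact key p hp

/-- Hahn–Banach separates x from the open interior; the direction opposite to the separating vector
is the required angle. -/
theorem exists_support_eq (hC : HasRadii C δ M) {x : Plane} (hx : x ∈ closure C)
    (hx' : x ∉ interior C) : ∃ θ, support C θ = radial x θ := by
  obtain ⟨f, hf⟩ := geometric_hahn_banach_open_point hC.convex.interior isOpen_interior hx'
  have hle : ∀ y ∈ C, f y ≤ f x := by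
    intro y hy
    have h1 : y ∈ closure (interior C) := by
      rw [hC.convex.closure_interior_eq_closure_of_nonempty_interior hC.nonempty_interior]
      exact subset_closure hy
    exact closure_minimal (t := {y | f y ≤ f x}) (fun z hz => (hf z hz).le)
      (isClosed_le f.continuous continuous_const) h1
  obtain ⟨v, rfl⟩ := (InnerProductSpace.toDual ℝ Plane).surjective f
  obtain ⟨θ, hθ⟩ := exists_eq_norm_smul_u (-v)
  have hinner : ∀ y, InnerProductSpace.toDual ℝ Plane v y = -(‖v‖ * radial y θ) := by
    intro y
    have h1 : inner ℝ (-v) y = ‖v‖ * radial y θ := by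
      conv_lhs => rw [hθ]
      rw [inner_smul_left, real_inner_comm, inner_u, norm_neg]
      simp
    rw [InnerProductSpace.toDual_apply_apply, ← h1, inner_neg_left, neg_neg]
  have hv : 0 < ‖v‖ := by
    rw [norm_pos_iff]
    rintro rfl
    obtain ⟨z, hz⟩ := hC.nonempty_interior
    have := hf z hz
    simp at this
  refine ⟨θ, le_antisymm (hC.support_le_of_mem_closure hx θ) (hC.le_support fun y hy => ?_)⟩
  have := hle y hy
  rw [hinner, hinner] at this
  exact le_of_mul_le_mul_left (by linarith) hv

end HasRadii

/-! ### The gauge, the polar boundary curve and its arc-length parameterization. -/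

namespace HasRadii

variable {C : Set Plane} {δ M : ℝ}

theorem convex_shift (hC : HasRadii C δ M) : Convex ℝ ((fun x => x - center C) '' C) := by
  have := hC.convex.translate (-center C)
  simpa only [neg_add_eq_sub] using this

theorem closedBall_subset_shift (hC : HasRadii C δ M) :
    Metric.closedBall 0 δ ⊆ (fun x => x - center C) '' C := by
  intro x hx
  refine ⟨x + center C, hC.closedBall_subset ?_, add_sub_cancel_right _ _⟩
  simpa [dist_eq_norm] using hx

theorem shift_mem_nhds (hC : HasRadii C δ M) : (fun x => x - center C) '' C ∈ 𝓝 (0 : Plane) :=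
  Filter.mem_of_superset (Metric.closedBall_mem_nhds _ hC.pos) hC.closedBall_subset_shift

theorem shift_subset_closedBall (hC : HasRadii C δ M) :
    (fun x => x - center C) '' C ⊆ Metric.closedBall 0 M := by
  rintro _ ⟨x, hx, rfl⟩
  simpa using hC.norm_le x hx

theorem mem_closure_iff (hC : HasRadii C δ M) (x : Plane) :
    x ∈ closure C ↔ bodyGauge C (x - center C) ≤ 1 := by
  rw [bodyGauge, gauge_le_one_iff_mem_closure hC.convex_shift hC.shift_mem_nhds,
    show (fun x => x - center C) '' C = Homeomorph.subRight (center C) '' C from rfl,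
    ← Homeomorph.image_closure]
  simp

theorem mem_interior_iff (hC : HasRadii C δ M) (x : Plane) :
    x ∈ interior C ↔ bodyGauge C (x - center C) < 1 := by
  rw [bodyGauge, gauge_lt_one_iff_mem_interior hC.convex_shift hC.shift_mem_nhds,
    show (fun x => x - center C) '' C = Homeomorph.subRight (center C) '' C from rfl,
    ← Homeomorph.image_interior]
  simp

theorem bodyGauge_add_le (hC : HasRadii C δ M) (x y : Plane) :
    bodyGauge C (x + y) ≤ bodyGauge C x + bodyGauge C y :=
  gauge_add_le hC.convex_shift (absorbent_nhds_zero hC.shift_mem_nhds) x y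

theorem bodyGauge_smul {r : ℝ} (hr : 0 ≤ r) (x : Plane) :
    bodyGauge C (r • x) = r * bodyGauge C x :=
  gauge_smul_of_nonneg hr x

theorem lipschitz_bodyGauge (hC : HasRadii C δ M) :
    LipschitzWith δ.toNNReal⁻¹ (bodyGauge C) := by
  refine hC.convex_shift.lipschitzWith_gauge (Real.toNNReal_pos.mpr hC.pos) ?_
  rw [Real.coe_toNNReal _ hC.pos.le]
  exact Metric.ball_subset_closedBall.trans hC.closedBall_subset_shift

theorem norm_div_le_bodyGauge (hC : HasRadii C δ M) (x : Plane) : ‖x‖ / M ≤ bodyGauge C x :=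
  le_gauge_of_subset_closedBall (absorbent_nhds_zero hC.shift_mem_nhds) hC.pos'.le
    hC.shift_subset_closedBall

theorem inv_le_bodyGauge_u (hC : HasRadii C δ M) (t : ℝ) : M⁻¹ ≤ bodyGauge C (u t) := by
  have := hC.norm_div_le_bodyGauge (u t)
  rwa [norm_u, one_div] at this

theorem bodyGauge_u_pos (hC : HasRadii C δ M) (t : ℝ) : 0 < bodyGauge C (u t) :=
  (inv_pos.mpr hC.pos').trans_le (hC.inv_le_bodyGauge_u t)

theorem polarCurve_sub_center (C : Set Plane) (t : ℝ) :
    polarCurve C t - center C = (bodyGauge C (u t))⁻¹ • u t :=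
  add_sub_cancel_left _ _

theorem inv_bodyGauge_u_le (hC : HasRadii C δ M) (t : ℝ) : (bodyGauge C (u t))⁻¹ ≤ M :=
  inv_le_of_inv_le₀ hC.pos' (hC.inv_le_bodyGauge_u t)

theorem norm_polarCurve_sub_le (hC : HasRadii C δ M) (t : ℝ) :
    ‖polarCurve C t - center C‖ ≤ M := by
  rw [polarCurve_sub_center, norm_smul, norm_u, mul_one, norm_inv, Real.norm_of_nonneg
    (hC.bodyGauge_u_pos t).le]
  exact hC.inv_bodyGauge_u_le t

theorem bodyGauge_polarCurve (hC : HasRadii C δ M) (t : ℝ) :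
    bodyGauge C (polarCurve C t - center C) = 1 := by
  rw [polarCurve_sub_center, bodyGauge_smul (inv_nonneg.mpr (hC.bodyGauge_u_pos t).le),
    inv_mul_cancel₀ (hC.bodyGauge_u_pos t).ne']

theorem polarCurve_mem_closure (hC : HasRadii C δ M) (t : ℝ) : polarCurve C t ∈ closure C :=
  (hC.mem_closure_iff _).mpr (hC.bodyGauge_polarCurve t).le

theorem polarCurve_notMem_interior (hC : HasRadii C δ M) (t : ℝ) :
    polarCurve C t ∉ interior C := by
  rw [hC.mem_interior_iff, hC.bodyGauge_polarCurve]
  exact lt_irrefl _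

theorem polarCurve_add_two_pi (C : Set Plane) (t : ℝ) :
    polarCurve C (t + 2 * Real.pi) = polarCurve C t := by
  rw [polarCurve, polarCurve, Real.Angle.coe_add, Real.Angle.coe_two_pi, add_zero]

/-- The gauge is Lipschitz with constant 1/δ and at least 1/M on unit vectors, so its reciprocal
along the unit circle is Lipschitz. -/
theorem lipschitz_polarCurve (hC : HasRadii C δ M) : ∃ K, LipschitzWith K (polarCurve C) := by
  have hM := hC.pos'
  have hδ := hC.pos
  have hK : 0 ≤ M * 2 + M * M * (δ⁻¹ * 2) := by positivity
  refine ⟨(M * 2 + M * M * (δ⁻¹ * 2)).toNNReal, LipschitzWith.of_dist_le_mul fun s t => ?_⟩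
  rw [Real.coe_toNNReal _ hK, dist_eq_norm, ← sub_sub_sub_cancel_right _ _ (center C),
    polarCurve_sub_center, polarCurve_sub_center, Real.dist_eq]
  set p := bodyGauge C (u s) with hp
  set q := bodyGauge C (u t) with hq
  have hp0 : 0 < p := hC.bodyGauge_u_pos s
  have hq0 : 0 < q := hC.bodyGauge_u_pos t
  have h1 : p⁻¹ • u (s : Real.Angle) - q⁻¹ • u (t : Real.Angle)
      = p⁻¹ • (u (s : Real.Angle) - u (t : Real.Angle)) + (p⁻¹ - q⁻¹) • u (t : Real.Angle) := by
    module
  have h2 := norm_u_sub_le s t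
  have h3 : |q - p| ≤ δ⁻¹ * (2 * |s - t|) := by
    have := hC.lipschitz_bodyGauge.dist_le_mul (u s) (u t)
    rw [NNReal.coe_inv, Real.coe_toNNReal _ hδ.le, Real.dist_eq, dist_eq_norm] at this
    rw [abs_sub_comm]
    exact this.trans (mul_le_mul_of_nonneg_left h2 (by positivity))
  have hpM : p⁻¹ ≤ M := hC.inv_bodyGauge_u_le s
  have hqM : q⁻¹ ≤ M := hC.inv_bodyGauge_u_le t
  have h4 : |p⁻¹ - q⁻¹| ≤ M * M * (δ⁻¹ * (2 * |s - t|)) := by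
    have : p⁻¹ - q⁻¹ = p⁻¹ * q⁻¹ * (q - p) := by field_simp
    rw [this, abs_mul, abs_of_pos (by positivity)]
    gcongr
  rw [h1]
  refine (norm_add_le _ _).trans ?_
  rw [norm_smul, norm_smul, norm_u, mul_one, Real.norm_eq_abs, Real.norm_eq_abs,
    abs_of_pos (by positivity : 0 < p⁻¹)]
  have h5 : p⁻¹ * ‖u (s : Real.Angle) - u (t : Real.Angle)‖ ≤ M * (2 * |s - t|) := by gcongr
  calc _ ≤ M * (2 * |s - t|) + M * M * (δ⁻¹ * (2 * |s - t|)) := add_le_add h5 h4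
    _ = _ := by ring

theorem cross_polarCurve (C : Set Plane) (s t : ℝ) :
    (polarCurve C s - center C) 0 * (polarCurve C t - center C) 1
      - (polarCurve C s - center C) 1 * (polarCurve C t - center C) 0
      = (bodyGauge C (u s))⁻¹ * (bodyGauge C (u t))⁻¹ * Real.sin (t - s) := by
  rw [polarCurve_sub_center, polarCurve_sub_center, u_coe, u_coe, Real.sin_sub]
  simp
  ring

theorem polarCurve_ne (hC : HasRadii C δ M) (t : ℝ) :
    polarCurve C t ≠ polarCurve C (t + Real.pi) := by
  intro h
  have h1 := congrArg (fun x => radial (x - center C) t) h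
  simp only [polarCurve_sub_center, radial_smul, radial_u, sub_self, Real.cos_zero,
    add_sub_cancel_left, Real.cos_pi] at h1
  have h2 := inv_pos.mpr (hC.bodyGauge_u_pos t)
  have h3 := inv_pos.mpr (hC.bodyGauge_u_pos (t + Real.pi))
  linarith

theorem arcParam_arcLength (hC : HasRadii C δ M) (t : ℝ) :
    arcParam C (arcLength (polarCurve C) t) = polarCurve C t := by
  obtain ⟨K, hK⟩ := hC.lipschitz_polarCurve
  exact naturalParameterization_arcLength hK t

theorem surjective_arcLength_polarCurve (hC : HasRadii C δ M) :
    Function.Surjective (arcLength (polarCurve C)) := by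
  obtain ⟨K, hK⟩ := hC.lipschitz_polarCurve
  have hpi := Real.pi_pos
  refine surjective_arcLength (T := 2 * Real.pi) (r := Real.pi) hK
    ⟨hpi.le, by linarith⟩ ?_ (polarCurve_add_two_pi C)
  simpa using hC.polarCurve_ne 0

theorem perimeter_pos (hC : HasRadii C δ M) : 0 < perimeter C := by
  obtain ⟨K, hK⟩ := hC.lipschitz_polarCurve
  have hpi := Real.pi_pos
  exact length_pos hK (r := Real.pi) ⟨hpi.le, by linarith⟩ (by simpa using hC.polarCurve_ne 0)

theorem arcLength_add_two_pi (hC : HasRadii C δ M) (t : ℝ) :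
    arcLength (polarCurve C) (t + 2 * Real.pi) = arcLength (polarCurve C) t + perimeter C := by
  obtain ⟨K, hK⟩ := hC.lipschitz_polarCurve
  have hpi := Real.pi_pos
  exact arcLength_add_period hK (by positivity) (polarCurve_add_two_pi C) t

theorem arcParam_add_perimeter (hC : HasRadii C δ M) (s : ℝ) :
    arcParam C (s + perimeter C) = arcParam C s := by
  obtain ⟨t, rfl⟩ := hC.surjective_arcLength_polarCurve s
  rw [← hC.arcLength_add_two_pi, hC.arcParam_arcLength, hC.arcParam_arcLength,
    polarCurve_add_two_pi]

theorem hasUnitSpeedOn_arcParam (hC : HasRadii C δ M) :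
    HasUnitSpeedOn (arcParam C) Set.univ := by
  obtain ⟨K, hK⟩ := hC.lipschitz_polarCurve
  exact hasUnitSpeedOn_naturalParameterization hK hC.surjective_arcLength_polarCurve

theorem lipschitz_arcParam (hC : HasRadii C δ M) : LipschitzWith 1 (arcParam C) :=
  lipschitzWith_of_hasUnitSpeedOn hC.hasUnitSpeedOn_arcParam

/-- A boundary point whose polar angle is ahead by at most π has nonnegative cross product with the
current one; right difference quotients suffice. -/
theorem arcParam_orient (hC : HasRadii C δ M) {s : ℝ}
    (hd : DifferentiableAt ℝ (arcParam C) s) :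
    0 ≤ (arcParam C s - center C) 0 * (deriv (arcParam C) s) 1
      - (arcParam C s - center C) 1 * (deriv (arcParam C) s) 0 := by
  obtain ⟨K, hK⟩ := hC.lipschitz_polarCurve
  obtain ⟨t, rfl⟩ := hC.surjective_arcLength_polarCurve s
  have hpi := Real.pi_pos
  set V := arcLength (polarCurve C) with hV
  have hVmono := monotone_arcLength hK
  have hlt : V t < V (t + Real.pi) := by
    refine lt_of_le_of_ne (hVmono (by linarith)) fun h => hC.polarCurve_ne t ?_
    rw [← hC.arcParam_arcLength, ← hC.arcParam_arcLength (t + Real.pi), ← hV, h]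
  set x := arcParam C (V t) - center C with hx
  set φ : ℝ → ℝ := fun r => x 0 * (arcParam C r - center C) 1 - x 1 * (arcParam C r - center C) 0
  have hφ : HasDerivAt φ (x 0 * (deriv (arcParam C) (V t)) 1
      - x 1 * (deriv (arcParam C) (V t)) 0) (V t) := by
    have h1 := hd.hasDerivAt.sub_const (center C)
    exact ((hasDerivAt_coord h1 1).const_mul _).sub ((hasDerivAt_coord h1 0).const_mul _)
  have hφ0 : φ (V t) = 0 := by simp only [φ, ← hx]; ring
  have hev : ∀ᶠ r in 𝓝[>] (V t), 0 ≤ slope φ (V t) r := by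
    filter_upwards [Ioo_mem_nhdsGT hlt] with r hr
    rw [slope_def_field, hφ0, sub_zero]
    refine div_nonneg ?_ (by linarith [hr.1])
    obtain ⟨t', ht', rfl⟩ := intermediate_value_Icc (by linarith : t ≤ t + Real.pi)
      (continuous_arcLength hK).continuousOn ⟨hr.1.le, hr.2.le⟩
    simp only [φ, hx]
    rw [← hV, hC.arcParam_arcLength, hC.arcParam_arcLength, cross_polarCurve]
    have h2 := inv_pos.mpr (hC.bodyGauge_u_pos t)
    have h3 := inv_pos.mpr (hC.bodyGauge_u_pos t')
    have h4 := Real.sin_nonneg_of_nonneg_of_le_pi (by linarith [ht'.1] : 0 ≤ t' - t)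
      (by linarith [ht'.2])
    positivity
  have hten := (hasDerivWithinAt_iff_tendsto_slope' (s := Set.Ioi (V t)) (x := V t)
    (by simp)).mp hφ.hasDerivWithinAt
  exact ge_of_tendsto hten hev

theorem isSupportedCurve (hC : HasRadii C δ M) :
    IsSupportedCurve (arcParam C) (support C) (center C) δ M where
  pos := hC.pos
  lipschitz := hC.lipschitz_arcParam
  speed := ae_norm_deriv_eq_one hC.lipschitz_arcParam hC.hasUnitSpeedOn_arcParam
  orient := by
    filter_upwards [hC.lipschitz_arcParam.ae_differentiableAt_real] with s hs
    exact hC.arcParam_orient hs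
  periodic := support_add_two_pi C
  lipschitz_support := hC.lipschitz_support
  le_radial s θ := by
    obtain ⟨t, rfl⟩ := hC.surjective_arcLength_polarCurve s
    rw [hC.arcParam_arcLength]
    exact hC.support_le_of_mem_closure (hC.polarCurve_mem_closure t) θ
  touch s := by
    obtain ⟨t, rfl⟩ := hC.surjective_arcLength_polarCurve s
    rw [hC.arcParam_arcLength]
    exact hC.exists_support_eq (hC.polarCurve_mem_closure t) (hC.polarCurve_notMem_interior t)
  concave := hC.support_concave
  deep := hC.support_deep
  bounded s := by
    obtain ⟨t, rfl⟩ := hC.surjective_arcLength_polarCurve s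
    rw [hC.arcParam_arcLength]
    exact hC.norm_polarCurve_sub_le t

end HasRadii

/-! ### Chords and caps in polar coordinates. -/

/-- Both strict and weak sublevel sets are needed: as C need not be closed, a chord is only squeezed
between the open and the closed interval. -/
theorem exists_sublevel_eq_interval {g : ℝ → ℝ} (hconv : ConvexOn ℝ Set.univ g)
    (hcont : Continuous g) {y₀ B : ℝ} (h0 : g y₀ < 1) (hB : ∀ y, g y ≤ 1 → |y| ≤ B) :
    ∃ y₁ y₂, y₁ < y₂ ∧ g y₁ = 1 ∧ g y₂ = 1 ∧ (∀ y, g y < 1 ↔ y ∈ Set.Ioo y₁ y₂) ∧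
      ∀ y, g y ≤ 1 ↔ y ∈ Set.Icc y₁ y₂ := by
  set S := {y | g y ≤ 1} with hS
  have hcl : IsClosed S := isClosed_le hcont continuous_const
  have hbelow : BddBelow S := ⟨-B, fun y hy => (abs_le.mp (hB y hy)).1⟩
  have habove : BddAbove S := ⟨B, fun y hy => (abs_le.mp (hB y hy)).2⟩
  have hy₀ : y₀ ∈ S := h0.le
  have h1 : g (sInf S) ≤ 1 := hcl.csInf_mem ⟨y₀, hy₀⟩ hbelow
  have h2 : g (sSup S) ≤ 1 := hcl.csSup_mem ⟨y₀, hy₀⟩ habove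
  have hle1 : ∀ y, g y ≤ 1 → sInf S ≤ y := fun y hy => csInf_le hbelow hy
  have hle2 : ∀ y, g y ≤ 1 → y ≤ sSup S := fun y hy => le_csSup habove hy
  set y₁ := sInf S
  set y₂ := sSup S
  have e1 : g y₁ = 1 := by
    refine le_antisymm h1 (not_lt.mp fun hlt => ?_)
    have hev : ∀ᶠ y in 𝓝[<] y₁, g y < 1 :=
      (hcont.continuousAt.eventually (gt_mem_nhds hlt)).filter_mono nhdsWithin_le_nhds
    obtain ⟨y, hy, hy'⟩ := (hev.and self_mem_nhdsWithin).exists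
    exact absurd (hle1 y hy.le) (not_le.mpr hy')
  have e2 : g y₂ = 1 := by
    refine le_antisymm h2 (not_lt.mp fun hlt => ?_)
    have hev : ∀ᶠ y in 𝓝[>] y₂, g y < 1 :=
      (hcont.continuousAt.eventually (gt_mem_nhds hlt)).filter_mono nhdsWithin_le_nhds
    obtain ⟨y, hy, hy'⟩ := (hev.and self_mem_nhdsWithin).exists
    exact absurd (hle2 y hy.le) (not_le.mpr hy')
  have l1 : y₁ < y₀ := lt_of_le_of_ne (hle1 _ h0.le) fun h => by rw [← h] at h0; linarith
  have l2 : y₀ < y₂ := lt_of_le_of_ne (hle2 _ h0.le) fun h => by rw [h] at h0; linarith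
  have key : ∀ z, g z = 1 → ∀ b, 0 < b → b ≤ 1 → g ((1 - b) * z + b * y₀) < 1 := by
    intro z hz b hb hb1
    have := hconv.2 (Set.mem_univ z) (Set.mem_univ y₀) (sub_nonneg.mpr hb1) hb.le (by ring)
    simp only [smul_eq_mul, hz] at this
    nlinarith
  have hin : ∀ y ∈ Set.Ioo y₁ y₂, g y < 1 := by
    intro y hy
    rcases le_total y y₀ with h | h
    · have := key y₁ e1 ((y - y₁) / (y₀ - y₁)) (div_pos (by linarith [hy.1]) (by linarith))
        ((div_le_one (by linarith)).mpr (by linarith))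
      rwa [show (1 - (y - y₁) / (y₀ - y₁)) * y₁ + (y - y₁) / (y₀ - y₁) * y₀ = y by
        have : y₀ - y₁ ≠ 0 := by linarith
        field_simp
        ring] at this
    · have := key y₂ e2 ((y₂ - y) / (y₂ - y₀)) (div_pos (by linarith [hy.2]) (by linarith))
        ((div_le_one (by linarith)).mpr (by linarith))
      rwa [show (1 - (y₂ - y) / (y₂ - y₀)) * y₂ + (y₂ - y) / (y₂ - y₀) * y₀ = y by
        have : y₂ - y₀ ≠ 0 := by linarith
        field_simp
        ring] at this
  refine ⟨y₁, y₂, l1.trans l2, e1, e2, fun y => ⟨fun hy => ⟨?_, ?_⟩, hin y⟩, fun y =>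
    ⟨fun hy => ⟨hle1 y hy, hle2 y hy⟩, fun hy => ?_⟩⟩
  · exact lt_of_le_of_ne (hle1 y hy.le) fun h => by rw [← h, e1] at hy; exact lt_irrefl _ hy
  · exact lt_of_le_of_ne (hle2 y hy.le) fun h => by rw [h, e2] at hy; exact lt_irrefl _ hy
  · rcases hy.1.eq_or_lt with h | h
    · rw [← h, e1]
    · rcases hy.2.eq_or_lt with h' | h'
      · rw [h', e2]
      · exact (hin y ⟨h, h'⟩).le

/-- The point with radial component `-D` and tangential component `y` in direction `θ`. -/
def linePoint (D θ y : ℝ) : Plane :=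
  y • u ((θ + Real.pi / 2 : ℝ) : Real.Angle) - D • u (θ : Real.Angle)

theorem linePoint_eq (D θ y : ℝ) : linePoint D θ y =
    !₂[-(y * Real.sin θ) - D * Real.cos θ, y * Real.cos θ - D * Real.sin θ] := by
  rw [linePoint, u_coe, u_coe, Real.cos_add_pi_div_two, Real.sin_add_pi_div_two]
  ext i
  fin_cases i <;> simp

theorem radial_linePoint (D θ y : ℝ) : radial (linePoint D θ y) θ = -D := by
  rw [linePoint_eq]
  have := Real.sin_sq_add_cos_sq θ
  simp only [radial]
  simp
  linear_combination (-D) * this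

theorem tangential_linePoint (D θ y : ℝ) : tangential (linePoint D θ y) θ = y := by
  rw [linePoint_eq]
  have := Real.sin_sq_add_cos_sq θ
  simp only [tangential]
  simp
  linear_combination y * this

theorem eq_linePoint (x : Plane) (θ : ℝ) : x = linePoint (-radial x θ) θ (tangential x θ) := by
  rw [linePoint_eq]
  have := Real.sin_sq_add_cos_sq θ
  ext i
  fin_cases i
  · simp [radial, tangential]
    linear_combination (-x 0) * this
  · simp [radial, tangential]
    linear_combination (-x 1) * this

theorem isometry_linePoint (D θ : ℝ) : Isometry (linePoint D θ) := by
  refine Isometry.of_dist_eq fun y z => ?_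
  rw [dist_eq_norm, linePoint, linePoint, sub_sub_sub_cancel_right, ← sub_smul, norm_smul, norm_u,
    mul_one, Real.dist_eq, Real.norm_eq_abs]

/-- With y = D tan ψ, homogeneity of the gauge turns membership along a line into a condition on the
polar angle. -/
theorem linePoint_mul_tan (D θ : ℝ) {ψ : ℝ} (hψ : Real.cos ψ ≠ 0) :
    linePoint D θ (D * Real.tan ψ) = (D / Real.cos ψ) • u ((θ + Real.pi - ψ : ℝ) : Real.Angle) := by
  rw [linePoint_eq, u_coe, show θ + Real.pi - ψ = θ - ψ + Real.pi by ring, Real.cos_add_pi,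
    Real.sin_add_pi, Real.cos_sub, Real.sin_sub, Real.tan_eq_sin_div_cos]
  ext i
  fin_cases i
  · simp
    field_simp
    ring
  · simp
    field_simp

namespace HasRadii

variable {C : Set Plane} {δ M : ℝ}

theorem convexOn_bodyGauge_linePoint (hC : HasRadii C δ M) (D θ : ℝ) :
    ConvexOn ℝ Set.univ fun y => bodyGauge C (linePoint D θ y) := by
  refine ⟨convex_univ, fun y _ z _ a b ha hb hab => ?_⟩
  have : linePoint D θ (a • y + b • z) = a • linePoint D θ y + b • linePoint D θ z := by
    rw [linePoint, linePoint, linePoint, smul_eq_mul, smul_eq_mul]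
    obtain rfl : b = 1 - a := by linarith
    module
  simp only [this]
  refine (hC.bodyGauge_add_le _ _).trans ?_
  rw [bodyGauge_smul ha, bodyGauge_smul hb, smul_eq_mul, smul_eq_mul]

/-- Description of the chord of height `lam` in direction `θ`, and of the corresponding cap, in
terms of the polar angles of the end points of the chord. -/
theorem exists_chord (hC : HasRadii C δ M) (θ : ℝ) {lam : ℝ} (hlam : 0 < lam) (hlt : lam < δ) :
    ∃ t₁ t₂, θ ≤ t₁ ∧ t₁ ≤ t₂ ∧ t₂ ≤ θ + 2 * Real.pi ∧
      tangential (polarCurve C t₂) θ ≤ tangential (polarCurve C t₁) θ ∧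
      chordLength C (θ : Real.Angle) lam
        = tangential (polarCurve C t₁) θ - tangential (polarCurve C t₂) θ ∧
      (∀ t ∈ Set.Icc θ (θ + 2 * Real.pi),
        radial (polarCurve C t) θ < support C θ + lam ↔ t ∈ Set.Ioo t₁ t₂) ∧
      ∀ x ∈ closure C, radial x θ = support C θ + lam →
        tangential x θ ∈ Set.Icc (tangential (polarCurve C t₂) θ)
          (tangential (polarCurve C t₁) θ) := by
  have hpi := Real.pi_pos
  -- Distance from the center to the line of the chord, positive because lam < δ.
  set D := radial (center C) θ - support C θ - lam with hD
  have hDpos : 0 < D := by have := hC.support_deep θ; linarith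
  set g : ℝ → ℝ := fun y => bodyGauge C (linePoint D θ y) with hg
  have hgc : Continuous g := hC.lipschitz_bodyGauge.continuous.comp (isometry_linePoint D θ).continuous
  -- The segment from the center to a point of C below the line crosses the line strictly before its
  -- end, hence at gauge less than 1.
  obtain ⟨y₀, hy₀⟩ : ∃ y₀, g y₀ < 1 := by
    obtain ⟨p, hp, hpr⟩ : ∃ p ∈ C, radial p θ < support C θ + lam := by
      by_contra! hcon
      have := hC.le_support hcon
      linarith
    set μ := D / (radial (center C) θ - radial p θ) with hμ
    have hpos : 0 < radial (center C) θ - radial p θ := by linarith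
    have hμ1 : μ < 1 := (div_lt_one hpos).mpr (by linarith)
    have hμ0 : 0 ≤ μ := (div_pos hDpos hpos).le
    have hr : radial (μ • (p - center C)) θ = -D := by
      rw [radial_smul, radial_sub, hμ]
      field_simp
      ring
    refine ⟨tangential (μ • (p - center C)) θ, ?_⟩
    have h1 := eq_linePoint (μ • (p - center C)) θ
    rw [hr, neg_neg] at h1
    simp only [hg]
    rw [← h1, bodyGauge_smul hμ0]
    have h2 := (hC.mem_closure_iff p).mp (subset_closure hp)
    have h3 : 0 ≤ bodyGauge C (p - center C) := gauge_nonneg _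
    nlinarith
  obtain ⟨y₁, y₂, hy12, e1, e2, hlt1, hle1⟩ := exists_sublevel_eq_interval (B := M)
    (hC.convexOn_bodyGauge_linePoint D θ) hgc hy₀ (by
      intro y hy
      have h1 := hC.norm_div_le_bodyGauge (linePoint D θ y)
      have h2 := abs_tangential_le (linePoint D θ y) θ
      rw [tangential_linePoint] at h2
      have h3 := h1.trans hy
      rw [div_le_one hC.pos'] at h3
      exact h2.trans h3)
  have hgpolar : ∀ ψ ∈ Set.Ioo (-(Real.pi / 2)) (Real.pi / 2), g (D * Real.tan ψ)
      = D / Real.cos ψ * bodyGauge C (u ((θ + Real.pi - ψ : ℝ) : Real.Angle)) := by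
    intro ψ hψ
    have hcos := Real.cos_pos_of_mem_Ioo hψ
    simp only [hg]
    rw [linePoint_mul_tan D θ hcos.ne', bodyGauge_smul (div_pos hDpos hcos).le]
  have hpt : ∀ y, g y = 1 →
      polarCurve C (θ + Real.pi - Real.arctan (y / D)) = center C + linePoint D θ y := by
    intro y hy
    have hψ := Real.arctan_mem_Ioo (y / D)
    have hcos := Real.cos_pos_of_mem_Ioo hψ
    have hy' : D * Real.tan (Real.arctan (y / D)) = y := by
      rw [Real.tan_arctan]; field_simp
    have h1 := hgpolar _ hψ
    rw [hy', hy] at h1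
    have hb := hC.bodyGauge_u_pos (θ + Real.pi - Real.arctan (y / D))
    rw [← sub_eq_iff_eq_add', polarCurve_sub_center]
    conv_rhs => rw [← hy', linePoint_mul_tan D θ hcos.ne']
    congr 1
    rw [inv_eq_one_div, div_eq_iff hb.ne', h1]
  have ht1 : tangential (polarCurve C (θ + Real.pi - Real.arctan (y₂ / D))) θ
      = tangential (center C) θ + y₂ := by
    rw [hpt y₂ e2, tangential_add, tangential_linePoint]
  have ht2 : tangential (polarCurve C (θ + Real.pi - Real.arctan (y₁ / D))) θ
      = tangential (center C) θ + y₁ := by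
    rw [hpt y₁ e1, tangential_add, tangential_linePoint]
  have hψ1 := Real.arctan_mem_Ioo (y₁ / D)
  have hψ2 := Real.arctan_mem_Ioo (y₂ / D)
  have harc : ∀ x, radial x θ = support C θ + lam →
      x - center C = linePoint D θ (tangential x θ - tangential (center C) θ) := by
    intro x hx
    have := eq_linePoint (x - center C) θ
    rwa [radial_sub, tangential_sub, hx, show -(support C θ + lam - radial (center C) θ) = D by
      rw [hD]; ring] at this
  -- Counterclockwise motion decreases the tangential coordinate in the cap, so the larger y₂ has
  -- the smaller polar angle.
  refine ⟨θ + Real.pi - Real.arctan (y₂ / D), θ + Real.pi - Real.arctan (y₁ / D),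
    by linarith [hψ2.2], ?_, by linarith [hψ1.1], by rw [ht1, ht2]; linarith, ?_, ?_, ?_⟩
  · have : Real.arctan (y₁ / D) ≤ Real.arctan (y₂ / D) :=
      Real.arctan_strictMono.monotone (by gcongr)
    linarith
  · rw [ht1, ht2, add_sub_add_left_eq_sub]
    set T := {y | center C + linePoint D θ y ∈ C} with hT
    have hchord : chord C (θ : Real.Angle) lam = (fun y => center C + linePoint D θ y) '' T := by
      ext x
      simp only [chord, inner_u, Set.mem_ofPred_eq, Set.mem_image, hT]
      constructor
      · rintro ⟨hx, hx'⟩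
        have := harc x hx'
        refine ⟨tangential x θ - tangential (center C) θ, ?_, ?_⟩
        · rw [← this, add_sub_cancel]; exact hx
        · rw [← this, add_sub_cancel]
      · rintro ⟨y, hy, rfl⟩
        refine ⟨hy, ?_⟩
        rw [radial_add, radial_linePoint, hD]
        simp only [support]
        ring
    have hiso : Isometry fun y => center C + linePoint D θ y :=
      (IsometryEquiv.addLeft (center C)).isometry.comp (isometry_linePoint D θ)
    have hsub1 : Set.Ioo y₁ y₂ ⊆ T := by
      intro y hy
      refine interior_subset (s := C) ((hC.mem_interior_iff _).mpr ?_)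
      rw [add_sub_cancel_left]
      exact (hlt1 y).mpr hy
    have hsub2 : T ⊆ Set.Icc y₁ y₂ := by
      intro y hy
      refine (hle1 y).mp ?_
      have := (hC.mem_closure_iff _).mp (subset_closure hy)
      rwa [add_sub_cancel_left] at this
    rw [chordLength, hchord, hiso.diam_image]
    refine le_antisymm ?_ ?_
    · rw [← Real.diam_Icc hy12.le]
      exact Metric.diam_mono hsub2 (Metric.isBounded_Icc _ _)
    · rw [← Real.diam_Ioo hy12.le]
      exact Metric.diam_mono hsub1 ((Metric.isBounded_Icc _ _).subset hsub2)
  · intro t ht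
    have hrad : radial (polarCurve C t) θ
        = radial (center C) θ + (bodyGauge C (u t))⁻¹ * Real.cos (t - θ) := by
      rw [← radial_u, ← radial_smul, ← polarCurve_sub_center, radial_sub]
      ring
    have hb := hC.bodyGauge_u_pos t
    rw [hrad, show radial (center C) θ + (bodyGauge C (u t))⁻¹ * Real.cos (t - θ)
      < support C θ + lam ↔ (bodyGauge C (u t))⁻¹ * Real.cos (t - θ) < -D by
        constructor <;> intro h <;> linarith]
    -- Only rays within a quarter turn of −u(θ) reach the line of the chord; on the others the point
    -- is no lower than the center.
    by_cases hmem : θ + Real.pi - t ∈ Set.Ioo (-(Real.pi / 2)) (Real.pi / 2)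
    · have hcos := Real.cos_pos_of_mem_Ioo hmem
      have hcos' : Real.cos (t - θ) = -Real.cos (θ + Real.pi - t) := by
        rw [show θ + Real.pi - t = Real.pi - (t - θ) by ring, Real.cos_pi_sub, neg_neg]
      have h1 := hgpolar _ hmem
      rw [sub_sub_cancel] at h1
      have h2 : (bodyGauge C (u t))⁻¹ * Real.cos (t - θ) < -D ↔
          g (D * Real.tan (θ + Real.pi - t)) < 1 := by
        rw [h1, hcos', mul_neg, neg_lt_neg_iff, div_mul_eq_mul_div, div_lt_one hcos,
          inv_mul_eq_div, lt_div_iff₀ hb]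
      rw [h2, hlt1]
      have htan : Real.arctan (Real.tan (θ + Real.pi - t)) = θ + Real.pi - t :=
        Real.arctan_tan hmem.1 hmem.2
      have e3 : y₁ < D * Real.tan (θ + Real.pi - t) ↔
          t < θ + Real.pi - Real.arctan (y₁ / D) := by
        rw [← div_lt_iff₀' hDpos, ← Real.arctan_strictMono.lt_iff_lt, htan]
        constructor <;> intro h <;> linarith
      have e4 : D * Real.tan (θ + Real.pi - t) < y₂ ↔
          θ + Real.pi - Real.arctan (y₂ / D) < t := by
        rw [← lt_div_iff₀' hDpos, ← Real.arctan_strictMono.lt_iff_lt, htan]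
        constructor <;> intro h <;> linarith
      rw [Set.mem_Ioo, Set.mem_Ioo, e3, e4, and_comm]
    · refine iff_of_false ?_ ?_
      · rw [not_lt]
        have : 0 ≤ Real.cos (t - θ) := by
          rw [Set.mem_Ioo, not_and_or, not_lt, not_lt] at hmem
          rcases hmem with h | h
          · rw [← Real.cos_sub_two_pi]
            exact Real.cos_nonneg_of_mem_Icc ⟨by linarith, by linarith [ht.2]⟩
          · exact Real.cos_nonneg_of_mem_Icc ⟨by linarith [ht.1], by linarith⟩
        have := mul_nonneg (inv_pos.mpr hb).le this
        linarith
      · rintro ⟨h1, h2⟩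
        exact hmem ⟨by linarith [hψ1.1], by linarith [hψ2.2]⟩
  · intro x hx hx'
    rw [ht1, ht2]
    have h1 := (hC.mem_closure_iff x).mp hx
    rw [harc x hx'] at h1
    have h2 := (hle1 _).mp h1
    exact ⟨by linarith [h2.1], by linarith [h2.2]⟩

end HasRadii

/-! ### Comparison of the swept density with the squared chord length. -/

theorem hasDerivAt_mul_abs_self (x : ℝ) : HasDerivAt (fun y : ℝ => y * |y|) (2 * |x|) x := by
  rcases lt_trichotomy x 0 with h | rfl | h
  · have h1 := (hasDerivAt_id x).mul (hasDerivAt_abs_neg h)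
    refine h1.congr_deriv ?_
    simp only [id, abs_of_neg h]
    ring
  · rw [hasDerivAt_iff_tendsto_slope]
    have h1 : Tendsto (fun y : ℝ => |y|) (𝓝[≠] 0) (𝓝 (2 * |0|)) := by
      have : Continuous fun y : ℝ => |y| := continuous_abs
      simpa using (this.tendsto 0).mono_left nhdsWithin_le_nhds
    refine h1.congr' ?_
    filter_upwards [self_mem_nhdsWithin] with y hy
    have hy' : y ≠ 0 := hy
    rw [slope_def_field]
    field_simp
    simp
  · have h1 := (hasDerivAt_id x).mul (hasDerivAt_abs_pos h)
    refine h1.congr_deriv ?_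
    simp only [id, abs_of_pos h]
    ring

theorem integral_abs_mul_deriv {r : ℝ → ℝ} {K : ℝ≥0} (hr : LipschitzWith K r) (p q : ℝ) :
    ∫ s in p..q, |r s| * deriv r s = r q * |r q| / 2 - r p * |r p| / 2 := by
  have h1 := (hr.lipschitzOnWith (s := Set.uIcc p q)).absolutelyContinuousOnInterval
  have habs : LipschitzWith K (fun s => |r s|) := by
    refine LipschitzWith.of_dist_le_mul fun x y => ?_
    refine le_trans ?_ (hr.dist_le_mul x y)
    rw [Real.dist_eq, Real.dist_eq]
    exact abs_abs_sub_abs_le_abs_sub _ _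
  have h2 := (habs.lipschitzOnWith (s := Set.uIcc p q)).absolutelyContinuousOnInterval
  have h3 := (h1.fun_mul h2).integral_deriv_eq_sub
  have h4 : ∫ s in p..q, deriv (fun s => r s * |r s|) s = ∫ s in p..q, 2 * (|r s| * deriv r s) := by
    refine intervalIntegral.integral_congr_ae ?_
    filter_upwards [hr.ae_differentiableAt_real] with s hs _
    have := (hasDerivAt_mul_abs_self (r s)).comp s hs.hasDerivAt
    rw [← mul_assoc]
    exact this.deriv
  rw [h4, intervalIntegral.integral_const_mul] at h3
  linarith

/-- For opposite signs the right side is 2(A² + B²), with equality at A = −B, so 4 is optimal. -/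
theorem sq_le_four_mul_sub {A B : ℝ} (h : A ≤ B) :
    (B - A) ^ 2 ≤ 4 * (B * |B| / 2 - A * |A| / 2) := by
  rcases le_total 0 A with hA | hA
  · rw [abs_of_nonneg hA, abs_of_nonneg (hA.trans h)]
    nlinarith
  · rw [abs_of_nonpos hA]
    rcases le_total 0 B with hB | hB
    · rw [abs_of_nonneg hB]
      nlinarith [sq_nonneg (A + B)]
    · rw [abs_of_nonpos hB]
      nlinarith

/-- For A ≤ 0 ≤ B the left side is (A² + B²)/2 ≤ (B − A)²/2. If both have the same sign, the excess
is min(|A|, |B|)·(B − A), which η controls. -/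
theorem sub_le_half_sq_add {A B η : ℝ} (hη : 0 ≤ η) (h : A ≤ B) (hA : A ≤ η) (hB : -η ≤ B) :
    B * |B| / 2 - A * |A| / 2 ≤ (B - A) ^ 2 / 2 + η * (B - A) := by
  rcases le_total 0 A with hA' | hA'
  · rw [abs_of_nonneg hA', abs_of_nonneg (hA'.trans h)]
    nlinarith
  · rw [abs_of_nonpos hA']
    rcases le_total 0 B with hB' | hB'
    · rw [abs_of_nonneg hB']
      nlinarith [mul_nonneg hη (sub_nonneg.mpr h), mul_nonneg (neg_nonneg.mpr hA') hB']
    · rw [abs_of_nonpos hB']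
      nlinarith

namespace HasRadii

variable {C : Set Plane} {δ M : ℝ}

/-- On the cap the density is −|r| r', with primitive −r|r|/2, so only the ends of the chord matter.
-/
theorem sweep_eq (hC : HasRadii C δ M) {θ lam t₁ t₂ : ℝ} (h1 : θ ≤ t₁) (h12 : t₁ ≤ t₂)
    (h2 : t₂ ≤ θ + 2 * Real.pi)
    (hcap : ∀ t ∈ Set.Icc θ (θ + 2 * Real.pi),
        radial (polarCurve C t) θ < support C θ + lam ↔ t ∈ Set.Ioo t₁ t₂) :
    sweep (arcParam C) (support C) (perimeter C) lam θ
      = (tangential (polarCurve C t₁) θ - deriv (support C) θ)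
          * |tangential (polarCurve C t₁) θ - deriv (support C) θ| / 2
        - (tangential (polarCurve C t₂) θ - deriv (support C) θ)
          * |tangential (polarCurve C t₂) θ - deriv (support C) θ| / 2 := by
  obtain ⟨K, hK⟩ := hC.lipschitz_polarCurve
  have H := hC.isSupportedCurve
  set X := arcParam C with hX
  set h := support C with hh
  set V := arcLength (polarCurve C) with hV
  have hVm : Monotone V := monotone_arcLength hK
  have hXV : ∀ t, X (V t) = polarCurve C t := hC.arcParam_arcLength
  have hper := hC.arcLength_add_two_pi θ
  have hL := hC.perimeter_pos
  set L := perimeter C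
  set S : Set ℝ := {s | height X h s θ < lam} with hS
  have hSm : MeasurableSet S := H.measurableSet_cap θ lam
  have hXper : Function.Periodic X L := hC.arcParam_add_perimeter
  have hfper : Function.Periodic (S.indicator fun s => density X h s θ) L := by
    intro s
    have h3 : deriv X (s + L) = deriv X s := by
      rw [← deriv_comp_add_const]
      exact congrArg (fun f => deriv f s) (funext hXper)
    simp only [hS, Set.indicator, height, density, hXper s, h3, Set.mem_ofPred_eq]
  -- Only weak monotonicity of arc length is used; removing the two end parameters restores the
  -- strict inequalities.
  have hset : (Set.Ioc (V θ) (V θ + L) ∩ S : Set ℝ) =ᵐ[volume] Set.Ioc (V t₁) (V t₂) := by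
    rw [Filter.eventuallyEq_set]
    filter_upwards [compl_mem_ae_iff.mpr (measure_singleton (μ := volume) (V t₁)),
      compl_mem_ae_iff.mpr (measure_singleton (μ := volume) (V t₂))] with s hs1 hs2
    have hlow : ∀ t ∈ Set.Icc θ (θ + 2 * Real.pi), V t ∈ S ↔ t ∈ Set.Ioo t₁ t₂ := by
      intro t ht
      rw [← hcap t ht]
      simp only [hS, Set.mem_ofPred_eq, height, hXV]
      rw [sub_lt_iff_lt_add']
    constructor
    · rintro ⟨hs, hsS⟩
      obtain ⟨t, ht, rfl⟩ := intermediate_value_Icc (by linarith : θ ≤ θ + 2 * Real.pi)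
        (continuous_arcLength hK).continuousOn ⟨hs.1.le, hs.2.trans hper.ge⟩
      have := (hlow t ht).mp hsS
      exact ⟨lt_of_le_of_ne (hVm this.1.le) (Ne.symm hs1), hVm this.2.le⟩
    · intro hs
      have hs' : s < V t₂ := lt_of_le_of_ne hs.2 hs2
      obtain ⟨t, rfl⟩ := hC.surjective_arcLength_polarCurve s
      have ht1 : t₁ < t := hVm.reflect_lt hs.1
      have ht2 : t < t₂ := hVm.reflect_lt hs'
      refine ⟨⟨(hVm h1).trans_lt hs.1, ?_⟩,
        (hlow t ⟨by linarith, by linarith⟩).mpr ⟨ht1, ht2⟩⟩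
      rw [← hper]
      exact hVm (by linarith)
  have hT : LipschitzWith 1 (fun s => tangential (X s) θ - deriv h θ) := by
    refine LipschitzWith.of_dist_le_mul fun x y => ?_
    rw [Real.dist_eq, sub_sub_sub_cancel_right, ← tangential_sub]
    refine (abs_tangential_le _ _).trans ?_
    rw [← dist_eq_norm]
    exact H.lipschitz.dist_le_mul x y
  calc sweep X h L lam θ = ∫ s in (0 : ℝ)..(0 + L), S.indicator (fun s => density X h s θ) s := by
        rw [sweep, ← setIntegral_indicator hSm, zero_add, intervalIntegral.integral_of_le hL.le,
          integral_Ico_eq_integral_Ioc]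
    -- Starting the period at polar angle θ, opposite to the cap, makes the cap a single interval.
    _ = ∫ s in V θ..(V θ + L), S.indicator (fun s => density X h s θ) s :=
        hfper.intervalIntegral_add_eq _ _
    _ = ∫ s in Set.Ioc (V θ) (V θ + L) ∩ S, density X h s θ := by
        rw [intervalIntegral.integral_of_le (by linarith), setIntegral_indicator hSm]
    _ = ∫ s in V t₁..V t₂, density X h s θ := by
        rw [intervalIntegral.integral_of_le (hVm h12), setIntegral_congr_set hset]
    _ = -∫ s in V t₁..V t₂, |tangential (X s) θ - deriv h θ|
          * deriv (fun s => tangential (X s) θ - deriv h θ) s := by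
        rw [← intervalIntegral.integral_neg]
        refine intervalIntegral.integral_congr_ae ?_
        filter_upwards [H.lipschitz.ae_differentiableAt_real] with s hs _
        rw [((hasDerivAt_tangential_comp hs.hasDerivAt θ).sub_const _).deriv, density, mul_neg]
    _ = _ := by
        rw [integral_abs_mul_deriv hT, hXV, hXV]
        ring

theorem chordLength_sq_le (hC : HasRadii C δ M) (θ : ℝ) {lam : ℝ} (hlam : 0 < lam)
    (hlt : lam < δ) :
    chordLength C (θ : Real.Angle) lam ^ 2
      ≤ 4 * sweep (arcParam C) (support C) (perimeter C) lam θ := by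
  obtain ⟨t₁, t₂, h1, h12, h2, hle, hlen, hcap, -⟩ := hC.exists_chord θ hlam hlt
  rw [hlen, hC.sweep_eq h1 h12 h2 hcap]
  have := sq_le_four_mul_sub (sub_le_sub_right hle (deriv (support C) θ))
  rwa [sub_sub_sub_cancel_right] at this

theorem norm_sub_center_le_of_mem_closure (hC : HasRadii C δ M) {x : Plane} (hx : x ∈ closure C) :
    ‖x - center C‖ ≤ M :=
  closure_minimal (t := {y | ‖y - center C‖ ≤ M}) hC.norm_le
    (isClosed_le (by fun_prop) continuous_const) hx

/-- At a point p attaining the minimum over the closure, φ ↦ p·u(φ) − h(φ) is minimal at θ, so its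
derivative vanishes there. -/
theorem exists_touching (hC : HasRadii C δ M) {θ : ℝ} (hd : DifferentiableAt ℝ (support C) θ) :
    ∃ p ∈ closure C, radial p θ = support C θ ∧ tangential p θ = deriv (support C) θ := by
  have hcomp : IsCompact (closure C) := by
    refine Metric.isCompact_of_isClosed_isBounded isClosed_closure ?_
    refine (Metric.isBounded_closedBall (x := center C) (r := M)).subset fun x hx => ?_
    rw [Metric.mem_closedBall, dist_eq_norm]
    exact hC.norm_sub_center_le_of_mem_closure hx
  obtain ⟨p, hp, hmin⟩ := hcomp.exists_isMinOn ⟨_, subset_closure hC.center_mem⟩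
    (continuous_radial θ).continuousOn
  have heq : radial p θ = support C θ := le_antisymm
    (hC.le_support fun y hy => hmin (subset_closure hy)) (hC.support_le_of_mem_closure hp θ)
  refine ⟨p, hp, heq, ?_⟩
  have hloc : IsLocalMin (fun φ => radial p φ - support C φ) θ := by
    refine Filter.Eventually.of_forall fun φ => ?_
    have := hC.support_le_of_mem_closure hp φ
    linarith
  have := hloc.hasDerivAt_eq_zero ((hasDerivAt_radial p θ).sub hd.hasDerivAt)
  linarith

/-- The segment from the contact point p to the center meets the chord's line inside the closed
body, at tangential distance at most (M/δ)·lam from p. So the contact coordinate h'(θ) is within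
that distance of the chord's range. -/
theorem sweep_le (hC : HasRadii C δ M) {θ : ℝ} (hd : DifferentiableAt ℝ (support C) θ) {lam ε : ℝ}
    (hlam : 0 < lam) (hlt : lam < δ) (hε : 0 < ε) :
    sweep (arcParam C) (support C) (perimeter C) lam θ
      ≤ (1 / 2 + ε) * chordLength C (θ : Real.Angle) lam ^ 2
        + (M / δ * lam) ^ 2 / (4 * ε) := by
  obtain ⟨t₁, t₂, h1, h12, h2, hle, hlen, hcap, hmem⟩ := hC.exists_chord θ hlam hlt
  obtain ⟨p, hp, hp1, hp2⟩ := hC.exists_touching hd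
  have hδ := hC.pos
  have hden : δ ≤ radial (center C) θ - radial p θ := by
    rw [hp1]; linarith [hC.support_deep θ]
  set μ := lam / (radial (center C) θ - radial p θ) with hμ
  have hμ0 : 0 < μ := div_pos hlam (hδ.trans_le hden)
  have hμ1 : μ ≤ 1 := (div_le_one (hδ.trans_le hden)).mpr (hlt.le.trans hden)
  have hμδ : μ ≤ lam / δ := div_le_div_of_nonneg_left hlam.le hδ hden
  have hz : p + μ • (center C - p) ∈ closure C :=
    hC.convex.closure.add_smul_sub_mem hp (subset_closure hC.center_mem) ⟨hμ0.le, hμ1⟩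
  have hzr : radial (p + μ • (center C - p)) θ = support C θ + lam := by
    rw [radial_add, radial_smul, radial_sub, hp1, hμ, hp1]
    have : radial (center C) θ - support C θ ≠ 0 := by rw [← hp1]; linarith
    field_simp
  have hzt := hmem _ hz hzr
  rw [tangential_add, tangential_smul, hp2] at hzt
  have hb : |μ * tangential (center C - p) θ| ≤ M / δ * lam := by
    rw [abs_mul, abs_of_pos hμ0]
    have h3 : |tangential (center C - p) θ| ≤ M := by
      refine (abs_tangential_le _ _).trans ?_
      rw [norm_sub_rev]
      exact hC.norm_sub_center_le_of_mem_closure hp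
    calc μ * |tangential (center C - p) θ| ≤ lam / δ * M :=
          mul_le_mul hμδ h3 (abs_nonneg _) (by positivity)
      _ = _ := by ring
  obtain ⟨hb1, hb2⟩ := abs_le.mp hb
  rw [hlen, hC.sweep_eq h1 h12 h2 hcap]
  have key := sub_le_half_sq_add (η := M / δ * lam)
    (by have := hC.pos'; positivity) (sub_le_sub_right hle (deriv (support C) θ))
    (by linarith [hzt.1]) (by linarith [hzt.2])
  rw [sub_sub_sub_cancel_right] at key
  refine key.trans ?_
  set ℓ := tangential (polarCurve C t₁) θ - tangential (polarCurve C t₂) θ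
  -- The cross term is traded for εℓ² plus O(lam²); with lam = 1/ρ the latter still vanishes after
  -- multiplication by ρ.
  have hamgm : M / δ * lam * ℓ ≤ ε * ℓ ^ 2 + (M / δ * lam) ^ 2 / (4 * ε) := by
    have h5 : ε * ℓ ^ 2 + (M / δ * lam) ^ 2 / (4 * ε) - M / δ * lam * ℓ
        = (2 * ε * ℓ - M / δ * lam) ^ 2 / (4 * ε) := by
      field_simp
      ring
    have h6 : 0 ≤ (2 * ε * ℓ - M / δ * lam) ^ 2 / (4 * ε) := by positivity
    linarith
  linarith

end HasRadii

/-! ### Both chords together, and the final limits. -/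

theorem opposite_arc (a b : ℝ) : opposite (arc a b) = arc (a + Real.pi) (b + Real.pi) := by
  rw [opposite, arc, arc, Set.image_image, ← Set.image_add_const_Icc, Set.image_image]
  simp only [Real.Angle.coe_add]

theorem gam_coe (C : Set Plane) (t lam : ℝ) : gam C (t : Real.Angle) lam
    = max (chordLength C (t : Real.Angle) lam)
        (chordLength C ((t + Real.pi : ℝ) : Real.Angle) lam) := by
  rw [gam, Real.Angle.coe_add]

theorem lintegral_Icc_add_right (f : ℝ → ℝ≥0∞) (a b c : ℝ) :
    ∫⁻ t in Set.Icc a b, f (t + c) = ∫⁻ t in Set.Icc (a + c) (b + c), f t := by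
  rw [← (measurePreserving_add_right volume c).setLIntegral_comp_preimage_emb
    (measurableEmbedding_addRight c) f (Set.Icc (a + c) (b + c))]
  simp

/-- If `D ≤ c * Y + e` where `D` converges to `p` and `e` to `0`, then `p ≤ c * liminf Y`. -/
theorem le_mul_liminf_of_tendsto {D Y e : ℝ → ℝ≥0∞} {p c : ℝ≥0∞} (hc : c ≠ ⊤)
    (hD : Tendsto D atTop (𝓝 p)) (he : Tendsto e atTop (𝓝 0))
    (hle : ∀ᶠ ρ in atTop, D ρ ≤ c * Y ρ + e ρ) : p ≤ c * liminf Y atTop := by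
  have h1 : Tendsto (fun ρ => D ρ - e ρ) atTop (𝓝 p) := by
    simpa using ENNReal.Tendsto.sub hD he (Or.inr ENNReal.zero_ne_top)
  rw [← h1.liminf_eq, ← ENNReal.liminf_const_mul_of_ne_top hc]
  refine liminf_le_liminf ?_
  filter_upwards [hle] with ρ hρ
  exact tsub_le_iff_right.mpr hρ

theorem le_of_forall_le_ofReal_mul {p q : ℝ≥0∞}
    (h : ∀ ε : ℝ, 0 < ε → p ≤ ENNReal.ofReal (1 + 2 * ε) * q) : p ≤ q := by
  have h1 : Tendsto (fun ε : ℝ => ENNReal.ofReal (1 + 2 * ε) * q) (𝓝[>] 0) (𝓝 (1 * q)) := by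
    refine ENNReal.Tendsto.mul_const ?_ (Or.inl one_ne_zero)
    have h2 : Continuous fun ε : ℝ => ENNReal.ofReal (1 + 2 * ε) :=
      ENNReal.continuous_ofReal.comp (by fun_prop)
    simpa using (h2.tendsto 0).mono_left nhdsWithin_le_nhds
  rw [one_mul] at h1
  refine ge_of_tendsto h1 ?_
  filter_upwards [self_mem_nhdsWithin] with ε hε
  exact h ε hε

namespace HasRadii

variable {C : Set Plane} {δ M : ℝ}

theorem portion_arc (hC : HasRadii C δ M) (a b : ℝ) : portion C (arc a b)
    = volume.restrict (Set.Ico 0 (perimeter C)) (touchSet (arcParam C) (support C) a b) := by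
  rw [Measure.restrict_apply (hC.isSupportedCurve.measurableSet_touchSet a b), portion]
  congr 1
  ext s
  simp only [Set.mem_ofPred_eq, Set.mem_inter_iff, touchSet, and_comm (a := s ∈ _)]
  refine and_congr_left fun _ => ?_
  constructor
  · rintro ⟨_, hn, θ, hθ, rfl⟩
    refine ⟨θ, hθ, ?_⟩
    have hn' : supportInf C (θ : Real.Angle) = inner ℝ (arcParam C s) (u θ) := hn
    rw [inner_u] at hn'
    rw [height, support, hn', sub_self]
  · rintro ⟨θ, hθ, h0⟩
    refine ⟨(θ : Real.Angle), ?_, θ, hθ, rfl⟩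
    simp only [normals, Set.mem_ofPred_eq]
    rw [inner_u]
    exact (sub_eq_zero.mp h0).symm

theorem lintegral_gam_le (hC : HasRadii C δ M) (a b : ℝ) {lam : ℝ} (hlam : 0 < lam)
    (hlt : lam < δ) :
    ∫⁻ t in Set.Icc a b, ENNReal.ofReal (gam C (t : Real.Angle) lam ^ 2)
      ≤ 4 * (∫⁻ t in Set.Icc a b,
            ENNReal.ofReal (sweep (arcParam C) (support C) (perimeter C) lam t))
        + 4 * ∫⁻ t in Set.Icc (a + Real.pi) (b + Real.pi),
            ENNReal.ofReal (sweep (arcParam C) (support C) (perimeter C) lam t) := by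
  have H := hC.isSupportedCurve
  have hm := (H.measurable_sweep (perimeter C) lam).ennreal_ofReal
  have hm' : Measurable fun t =>
      ENNReal.ofReal (sweep (arcParam C) (support C) (perimeter C) lam (t + Real.pi)) :=
    hm.comp (measurable_id.add_const _)
  rw [← lintegral_Icc_add_right, ← lintegral_const_mul _ hm, ← lintegral_const_mul _ hm',
    ← lintegral_add_left (hm.const_mul _)]
  refine lintegral_mono fun t => ?_
  have h1 := hC.chordLength_sq_le t hlam hlt
  have h2 := hC.chordLength_sq_le (t + Real.pi) hlam hlt
  have h4 : (4 : ℝ≥0∞) = ENNReal.ofReal 4 := by simp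
  simp only
  rw [gam_coe, h4, ← ENNReal.ofReal_mul (by norm_num), ← ENNReal.ofReal_mul (by norm_num)]
  rcases max_choice (chordLength C (t : Real.Angle) lam)
    (chordLength C ((t + Real.pi : ℝ) : Real.Angle) lam) with h | h <;> rw [h]
  · exact (ENNReal.ofReal_le_ofReal h1).trans le_self_add
  · exact (ENNReal.ofReal_le_ofReal h2).trans le_add_self

theorem chordLength_sq_le_gam_sq (C : Set Plane) (t lam : ℝ) :
    chordLength C (t : Real.Angle) lam ^ 2 ≤ gam C (t : Real.Angle) lam ^ 2 ∧
      chordLength C ((t + Real.pi : ℝ) : Real.Angle) lam ^ 2 ≤ gam C (t : Real.Angle) lam ^ 2 := by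
  rw [gam_coe]
  exact ⟨pow_le_pow_left₀ Metric.diam_nonneg (le_max_left _ _) 2,
    pow_le_pow_left₀ Metric.diam_nonneg (le_max_right _ _) 2⟩

/-- The swept area in directions shifted by `c` is controlled by any majorant `g` of the
lengths of the chords in those directions. -/
theorem lintegral_sweep_le_of_chordLength_le (hC : HasRadii C δ M) {a b c lam ε : ℝ}
    {g : ℝ → ℝ} (hlam : 0 < lam) (hlt : lam < δ) (hε : 0 < ε)
    (hg : ∀ t, chordLength C ((t + c : ℝ) : Real.Angle) lam ^ 2 ≤ g t) :
    ∫⁻ t in Set.Icc (a + c) (b + c),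
        ENNReal.ofReal (sweep (arcParam C) (support C) (perimeter C) lam t)
      ≤ ENNReal.ofReal (1 / 2 + ε) * (∫⁻ t in Set.Icc a b, ENNReal.ofReal (g t))
        + ENNReal.ofReal ((M / δ * lam) ^ 2 / (4 * ε)) * ENNReal.ofReal (b - a) := by
  obtain ⟨K, hK⟩ := hC.lipschitz_support
  rw [← lintegral_Icc_add_right]
  have hd : ∀ᵐ t : ℝ, DifferentiableAt ℝ (support C) (t + c) :=
    (measurePreserving_add_right volume c).quasiMeasurePreserving.ae hK.ae_differentiableAt_real
  calc ∫⁻ t in Set.Icc a b,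
        ENNReal.ofReal (sweep (arcParam C) (support C) (perimeter C) lam (t + c))
      ≤ ∫⁻ t in Set.Icc a b, (ENNReal.ofReal (1 / 2 + ε) * ENNReal.ofReal (g t)
          + ENNReal.ofReal ((M / δ * lam) ^ 2 / (4 * ε))) := by
        refine lintegral_mono_ae (ae_restrict_of_ae ?_)
        filter_upwards [hd] with t ht
        rw [← ENNReal.ofReal_mul (by positivity), ← ENNReal.ofReal_add
          (mul_nonneg (by positivity) ((sq_nonneg _).trans (hg t))) (by positivity)]
        refine ENNReal.ofReal_le_ofReal ((hC.sweep_le ht hlam hlt hε).trans ?_)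
        gcongr
        exact hg t
    _ = _ := by
        rw [lintegral_add_right _ measurable_const,
          lintegral_const_mul' _ _ ENNReal.ofReal_ne_top, setLIntegral_const, Real.volume_Icc]

end HasRadii

namespace HasRadii

variable {C : Set Plane} {δ M : ℝ}

theorem portion_add_le_liminf (hC : HasRadii C δ M) {a b : ℝ} (hab : a < b)
    (hba : b ≤ a + 2 * Real.pi) :
    portion C (arc a b) + portion C (opposite (arc a b))
      ≤ liminf (fun ρ : ℝ => ENNReal.ofReal ρ *
          ∫⁻ t in Set.Icc a b, ENNReal.ofReal (gam C (t : Real.Angle) ρ⁻¹ ^ 2)) atTop := by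
  have H := hC.isSupportedCurve
  have hδ := hC.pos
  rw [opposite_arc, hC.portion_arc, hC.portion_arc]
  set X := arcParam C
  set h := support C
  set L := perimeter C
  refine le_of_forall_le_ofReal_mul fun ε hε => ?_
  have hab' : a + Real.pi < b + Real.pi := by linarith
  have hba' : b + Real.pi ≤ a + Real.pi + 2 * Real.pi := by linarith
  set κ := (M / δ) ^ 2 / (4 * ε) with hκ
  have hκ0 : 0 ≤ κ := by positivity
  have herr : Tendsto (fun ρ : ℝ => ENNReal.ofReal (κ * ρ⁻¹) * ENNReal.ofReal (b - a)) atTop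
      (𝓝 0) := by
    have h1 : Tendsto (fun ρ : ℝ => ENNReal.ofReal (κ * ρ⁻¹)) atTop (𝓝 0) := by
      simpa using ENNReal.tendsto_ofReal (tendsto_inv_atTop_zero.const_mul κ)
    simpa using ENNReal.Tendsto.mul_const h1 (Or.inr ENNReal.ofReal_ne_top)
  -- Used with c = 0 and c = π: γ dominates the chords in both directions.
  have key : ∀ c : ℝ, (∀ lam t, chordLength C ((t + c : ℝ) : Real.Angle) lam ^ 2
      ≤ gam C (t : Real.Angle) lam ^ 2) → ∀ᶠ ρ : ℝ in atTop,
      ∫⁻ s in Set.Ico 0 L, min (ENNReal.ofReal ρ * posSweep X h (a + c) (b + c) ρ⁻¹ s) 1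
        ≤ ENNReal.ofReal (1 / 2 + ε) * (ENNReal.ofReal ρ *
            ∫⁻ t in Set.Icc a b, ENNReal.ofReal (gam C (t : Real.Angle) ρ⁻¹ ^ 2))
          + (ENNReal.ofReal (κ * ρ⁻¹) * ENNReal.ofReal (b - a)
            + ENNReal.ofReal ρ * ∫⁻ s in Set.Ico 0 L, negSweep X h (a + c) (b + c) ρ⁻¹ s) := by
    intro c hc
    filter_upwards [eventually_inv_le (half_pos hδ)] with ρ hρ
    have h1 := hC.lintegral_sweep_le_of_chordLength_le (a := a) (b := b) (inv_pos.mpr hρ.1)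
      (by linarith [hρ.2] : ρ⁻¹ < δ) hε (hc ρ⁻¹)
    have h2 := H.lintegral_posSweep_le_add (a + c) (b + c) L ρ⁻¹
    have hκρ : ENNReal.ofReal ρ * ENNReal.ofReal ((M / δ * ρ⁻¹) ^ 2 / (4 * ε))
        = ENNReal.ofReal (κ * ρ⁻¹) := by
      rw [← ENNReal.ofReal_mul hρ.1.le]
      congr 1
      have := hρ.1.ne'
      rw [hκ]
      field_simp
    calc ∫⁻ s in Set.Ico 0 L, min (ENNReal.ofReal ρ * posSweep X h (a + c) (b + c) ρ⁻¹ s) 1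
        ≤ ∫⁻ s in Set.Ico 0 L, ENNReal.ofReal ρ * posSweep X h (a + c) (b + c) ρ⁻¹ s :=
          lintegral_mono fun s => min_le_left _ _
      _ = ENNReal.ofReal ρ * ∫⁻ s in Set.Ico 0 L, posSweep X h (a + c) (b + c) ρ⁻¹ s :=
          lintegral_const_mul _ (H.measurable_posSweep _ _ _)
      _ ≤ ENNReal.ofReal ρ * ((ENNReal.ofReal (1 / 2 + ε) *
              (∫⁻ t in Set.Icc a b, ENNReal.ofReal (gam C (t : Real.Angle) ρ⁻¹ ^ 2))
            + ENNReal.ofReal ((M / δ * ρ⁻¹) ^ 2 / (4 * ε)) * ENNReal.ofReal (b - a))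
            + ∫⁻ s in Set.Ico 0 L, negSweep X h (a + c) (b + c) ρ⁻¹ s) :=
          mul_le_mul_right (h2.trans (add_le_add_left h1 _)) _
      _ = _ := by
          rw [← hκρ]
          ring
  have k1 := key 0 fun lam t => by
    rw [add_zero]
    exact (chordLength_sq_le_gam_sq C t lam).1
  have k2 := key Real.pi fun lam t => (chordLength_sq_le_gam_sq C t lam).2
  simp only [add_zero] at k1
  refine le_mul_liminf_of_tendsto ENNReal.ofReal_ne_top
    ((H.tendsto_lintegral_min_posSweep hab hba L).add
      (H.tendsto_lintegral_min_posSweep hab' hba' L))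
    (e := fun ρ => (ENNReal.ofReal (κ * ρ⁻¹) * ENNReal.ofReal (b - a)
            + ENNReal.ofReal ρ * ∫⁻ s in Set.Ico 0 L, negSweep X h a b ρ⁻¹ s)
          + (ENNReal.ofReal (κ * ρ⁻¹) * ENNReal.ofReal (b - a)
            + ENNReal.ofReal ρ * ∫⁻ s in Set.Ico 0 L,
                negSweep X h (a + Real.pi) (b + Real.pi) ρ⁻¹ s)) ?_ ?_
  · simpa using (herr.add (H.tendsto_lintegral_negSweep hab hba L)).add
      (herr.add (H.tendsto_lintegral_negSweep hab' hba' L))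
  · filter_upwards [k1, k2] with ρ h1 h2
    refine (add_le_add h1 h2).trans (le_of_eq ?_)
    -- Each of the two directions costs a factor 1/2 + ε of the same integral of γ².
    rw [show (1 + 2 * ε : ℝ) = (1 / 2 + ε) + (1 / 2 + ε) by ring,
      ENNReal.ofReal_add (p := 1 / 2 + ε) (by positivity) (by positivity)]
    ring

/-- The 8 is 4 from `chordLength_sq_le` times 2 from the two sides of the normal in `posSweep_le`.
-/
theorem limsup_le_portion_add (hC : HasRadii C δ M) {a b : ℝ} (hba : b ≤ a + 2 * Real.pi) :
    limsup (fun ρ : ℝ => ENNReal.ofReal ρ *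
          ∫⁻ t in Set.Icc a b, ENNReal.ofReal (gam C (t : Real.Angle) ρ⁻¹ ^ 2)) atTop
      ≤ 8 * portion C (arc a b) + 8 * portion C (opposite (arc a b)) := by
  have H := hC.isSupportedCurve
  have hδ := hC.pos
  rw [opposite_arc, hC.portion_arc, hC.portion_arc]
  have hba' : b + Real.pi ≤ a + Real.pi + 2 * Real.pi := by linarith
  have hlim := (ENNReal.Tendsto.const_mul (a := 8) (H.tendsto_measure_lowSet a b (perimeter C))
    (Or.inr (by simp))).add (ENNReal.Tendsto.const_mul (a := 8)
      (H.tendsto_measure_lowSet (a + Real.pi) (b + Real.pi) (perimeter C)) (Or.inr (by simp)))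
  rw [← hlim.limsup_eq]
  refine limsup_le_limsup ?_
  filter_upwards [eventually_inv_le (half_pos hδ)] with ρ hρ
  have h1 := hC.lintegral_gam_le a b (inv_pos.mpr hρ.1) (by linarith [hρ.2] : ρ⁻¹ < δ)
  have key : ∀ p q : ℝ, q ≤ p + 2 * Real.pi → ENNReal.ofReal ρ * (4 * ∫⁻ t in Set.Icc p q,
      ENNReal.ofReal (sweep (arcParam C) (support C) (perimeter C) ρ⁻¹ t))
      ≤ 8 * volume.restrict (Set.Ico 0 (perimeter C))
          (lowSet (arcParam C) (support C) p q ρ⁻¹) := by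
    intro p q hpq
    calc _ = 4 * (ENNReal.ofReal ρ * ∫⁻ t in Set.Icc p q,
          ENNReal.ofReal (sweep (arcParam C) (support C) (perimeter C) ρ⁻¹ t)) :=
          mul_left_comm _ _ _
      _ ≤ 4 * (2 * volume.restrict (Set.Ico 0 (perimeter C))
          (lowSet (arcParam C) (support C) p q ρ⁻¹)) :=
          mul_le_mul_right ((mul_le_mul_right (H.lintegral_sweep_le p q _ _) _).trans
            (H.lintegral_posSweep_le hpq _ hρ.1)) _
      _ = _ := by rw [← mul_assoc]; norm_num
  refine (mul_le_mul_right h1 _).trans ?_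
  rw [mul_add]
  exact add_le_add (key a b hba) (key _ _ hba')

end HasRadii

end PlanarBody

end
theorem corollaryc2 (C : Set PlanarBody.Plane) (hC : PlanarBody.IsConvexBody C)
    (a b : ℝ) (hab : a < b) (hba : b ≤ a + 2 * Real.pi) :
    PlanarBody.portion C (PlanarBody.arc a b)
          + PlanarBody.portion C (PlanarBody.opposite (PlanarBody.arc a b))
        ≤ Filter.liminf (fun ρ : ℝ => ENNReal.ofReal ρ *
            ∫⁻ t in Set.Icc a b, ENNReal.ofReal (PlanarBody.gam C (t : Real.Angle) ρ⁻¹ ^ 2))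
            Filter.atTop ∧
    Filter.limsup (fun ρ : ℝ => ENNReal.ofReal ρ *
            ∫⁻ t in Set.Icc a b, ENNReal.ofReal (PlanarBody.gam C (t : Real.Angle) ρ⁻¹ ^ 2))
            Filter.atTop
        ≤ 8 * PlanarBody.portion C (PlanarBody.arc a b)
          + 8 * PlanarBody.portion C (PlanarBody.opposite (PlanarBody.arc a b)) := by
  obtain ⟨δ, M, h⟩ := hC.exists_hasRadii
  exact ⟨h.portion_add_le_liminf hab hba, h.limsup_le_portion_add hba⟩
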